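/- For a real $m\times n$ matrix $A$ let $\mathrm{disc}(A)=\min_{u\in\{-1,+1\}^n}\|Au\|_\infty$. For $p\in[0,1]$ the $(m,n,p)$-Bernoulli ensemble is the $m\times n$ random matrix with independent entries, each equal to $1$ with probability $p$ and to $0$ with probability $1-p$. There is a universal constant $C>0$ such that the following holds. Let $n=n(m)\in\mathbb N$ and $p=p(m)\in[0,1/2]$ be sequences indexed by $m\in\mathbb N$ with $n(m)\ge C\,m\log m$ for all sufficiently large $m$ and $m=o(n(m)p(m))$ as $m\to\infty$. If, for each $m$, $A_m$ is drawn from the $(m,n(m),p(m))$-Bernoulli ensemble, then $\Pr[\mathrm{disc}(A_m)=1]\to 1$ as $m\to\infty$. -/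

import Mathlib

open MeasureTheory ProbabilityTheory Filter Topology Asymptotics unitInterval

/-- The real vector in `{-1, 1}ⁿ` given by a choice of signs (`ℤˣ` is the two-element set of
units `1`, `-1` of the integers). -/
def signVec {n : ℕ} (u : Fin n → ℤˣ) : Fin n → ℝ := fun j => ((u j : ℤ) : ℝ)

/-- The discrepancy of an `m × n` real matrix: the minimum over `u ∈ {-1, 1}ⁿ` of the sup norm
of `A u` (the norm on `Fin m → ℝ` is the sup norm). -/
noncomputable def disc {m n : ℕ} (A : Matrix (Fin m) (Fin n) ℝ) : ℝ :=
  Finset.univ.inf' Finset.univ_nonempty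
    (fun u : Fin n → ℤˣ => ‖A.mulVec (signVec u)‖)

/-- `A` is a random matrix from the `(m, n, p)`-Bernoulli ensemble: its entries are jointly
independent, and each of them equals `1` with probability `p` and `0` with probability `1 - p`. -/
structure IsBernoulliEnsemble {Ω : Type*} [MeasurableSpace Ω] (P : Measure Ω) {m n : ℕ}
    (p : I) (A : Ω → Matrix (Fin m) (Fin n) ℝ) : Prop where
  hasLaw_entry : ∀ i j, HasLaw (fun ω => A ω i j) (bernoulliMeasure (1 : ℝ) 0 p) P
  indep : iIndepFun (fun (ij : Fin m × Fin n) (ω : Ω) => A ω ij.1 ij.2) P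

/-! The upper bound is a second moment argument over a structured family of signings. Pair up the
columns and give the two columns of each pair opposite signs, with free signs `ε`. Each row then
becomes a signed sum of independent lazy steps, `±1` with probability `τ = p(1-p)` each. The walk is
asked to end at `0` or `-1`, so an unpaired last column, which adds `0` or `1`, does no harm. The
window has one value of each parity: two signings give sums of equal parity in every row, and with
this window that correlation costs nothing to leading order.

Let `k = n / 2`. If `ε, ε'` agree at `a` and differ at `b` positions, both walks are in the window
only if the walk over the differing positions returns to `0` and the other is in the window
(`sum_rowWeight_nearZero_and_le`). Gaussian estimates of the Fourier integrals bound the pair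
probability by `q² exp(x + O(1/(τk)))`, where `q` is the single probability and `x = ((a-b)/k)²`, as
long as `a, b ≥ k/4` (`two_mul_returnProb_mul_returnProb_le`). Over `m` rows the error is
`O(m/(τk))`, which vanishes because `m = o(np)`; the average of `exp(m x)` is at most `(1 -
2m/k)^(-1/2)`, which tends to `1` (`sum_exp_sq_sum_sign_le`). Unbalanced pairs are exponentially
rare in `k`, while a row costs at most a factor `1/q ≤ 2√k`; this is where `n ≥ C m log m` enters.
So the ratio of moments tends to `1`, and a good signing exists with high probability.

For the lower bound, a row with an odd number of ones has a nonzero integer product with every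
signing, and all rows are even with probability at most `(3/4)^m`. -/

/-! ### Local limit estimates for the lazy walk -/

/-- The characteristic function of the lazy step taking the values `1` and `-1` with probability
`τ` each and the value `0` otherwise. -/
noncomputable def lazyChar (τ θ : ℝ) : ℝ := 1 - 2 * τ * (1 - Real.cos θ)

/-- The probability that the lazy walk is at `0` after `a` steps, by Fourier inversion. -/
noncomputable def returnProb (τ : ℝ) (a : ℕ) : ℝ :=
  (2 * Real.pi)⁻¹ * ∫ θ in -Real.pi..Real.pi, lazyChar τ θ ^ a

/-- The probability that the lazy walk is at `-1` after `a` steps, by Fourier inversion. -/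
noncomputable def neighborProb (τ : ℝ) (a : ℕ) : ℝ :=
  (2 * Real.pi)⁻¹ * ∫ θ in -Real.pi..Real.pi, lazyChar τ θ ^ a * Real.cos θ

lemma continuous_lazyChar (τ : ℝ) : Continuous (lazyChar τ) := by
  unfold lazyChar; fun_prop

lemma lazyChar_nonneg {τ : ℝ} (h0 : 0 ≤ τ) (h : τ ≤ 1 / 4) (θ : ℝ) : 0 ≤ lazyChar τ θ := by
  unfold lazyChar
  nlinarith [Real.neg_one_le_cos θ, Real.cos_le_one θ]

lemma lazyChar_le_exp (τ θ : ℝ) :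
    lazyChar τ θ ≤ Real.exp (-(2 * τ * (1 - Real.cos θ))) := by
  unfold lazyChar
  linarith [Real.add_one_le_exp (-(2 * τ * (1 - Real.cos θ)))]

lemma neighborProb_le_returnProb {τ : ℝ} (h0 : 0 ≤ τ) (h : τ ≤ 1 / 4) (a : ℕ) :
    neighborProb τ a ≤ returnProb τ a := by
  unfold neighborProb returnProb
  have := continuous_lazyChar τ
  refine mul_le_mul_of_nonneg_left ?_ (by positivity)
  refine intervalIntegral.integral_mono_on (by linarith [Real.pi_pos])
    (Continuous.intervalIntegrable (by fun_prop) _ _)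
    (Continuous.intervalIntegrable (by fun_prop) _ _) fun θ _ => ?_
  have := pow_nonneg (lazyChar_nonneg h0 h θ) a
  nlinarith [Real.cos_le_one θ]

lemma returnProb_nonneg {τ : ℝ} (h0 : 0 ≤ τ) (h : τ ≤ 1 / 4) (a : ℕ) : 0 ≤ returnProb τ a := by
  unfold returnProb
  refine mul_nonneg (by positivity) ?_
  exact intervalIntegral.integral_nonneg (by linarith [Real.pi_pos])
    fun θ _ => pow_nonneg (lazyChar_nonneg h0 h θ) a

/-- A polynomial factor is absorbed by slower decay; with `y = s θ²` this turns Taylor errors into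
Gaussians carrying a factor `1/s`. -/
lemma add_sq_mul_exp_neg_le {y : ℝ} (hy : 0 ≤ y) :
    (y + y ^ 2) * Real.exp (-(y / 3)) ≤ 72 * Real.exp (-(y / 6)) := by
  have h : Real.exp (-(y / 3)) = Real.exp (-(y / 6)) * Real.exp (-(y / 6)) := by
    rw [← Real.exp_add]; ring_nf
  have h1 := Real.quadratic_le_exp_of_nonneg (x := y / 6) (by positivity)
  have h2 : Real.exp (y / 6) * Real.exp (-(y / 6)) = 1 := by rw [← Real.exp_add]; simp
  have h3 := Real.exp_pos (-(y / 6))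
  have h4 : (y + y ^ 2) * Real.exp (-(y / 6)) ≤ 72 := by
    calc _ ≤ (72 * Real.exp (y / 6)) * Real.exp (-(y / 6)) := by gcongr; nlinarith
      _ = 72 := by rw [mul_assoc, h2, mul_one]
  rw [h, ← mul_assoc]
  gcongr

lemma add_sq_mul_exp_neg_le' {y : ℝ} (hy : 0 ≤ y) :
    (2 * y + 2 * y ^ 2) * Real.exp (-y) ≤ 16 * Real.exp (-(y / 2)) := by
  have h : Real.exp (-y) = Real.exp (-(y / 2)) * Real.exp (-(y / 2)) := by
    rw [← Real.exp_add]; ring_nf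
  have h1 := Real.quadratic_le_exp_of_nonneg (x := y / 2) (by positivity)
  have h2 : Real.exp (y / 2) * Real.exp (-(y / 2)) = 1 := by rw [← Real.exp_add]; simp
  have h4 : (2 * y + 2 * y ^ 2) * Real.exp (-(y / 2)) ≤ 16 := by
    calc _ ≤ (16 * Real.exp (y / 2)) * Real.exp (-(y / 2)) := by gcongr; nlinarith
      _ = 16 := by rw [mul_assoc, h2, mul_one]
  rw [h, ← mul_assoc]
  gcongr

lemma lazyChar_pow_le {τ : ℝ} (h0 : 0 < τ) (h : τ ≤ 1 / 4) {a : ℕ} (ha : 0 < a) {θ : ℝ}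
    (hθ : |θ| ≤ Real.pi) :
    lazyChar τ θ ^ a ≤ Real.exp (-(τ * a) * θ ^ 2)
      + 72 / (τ * a) * Real.exp (-(τ * a / 6) * θ ^ 2) := by
  have ha' : (0 : ℝ) < a := by exact_mod_cast ha
  set s := τ * a with hs
  have hs0 : 0 < s := by positivity
  have h1 : lazyChar τ θ ^ a ≤ Real.exp (-(2 * s * (1 - Real.cos θ))) := by
    calc _ ≤ Real.exp (-(2 * τ * (1 - Real.cos θ))) ^ a :=
          pow_le_pow_left₀ (lazyChar_nonneg h0.le h θ) (lazyChar_le_exp τ θ) a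
      _ = _ := by rw [← Real.exp_nat_mul]; congr 1; rw [hs]; ring
  have h2 : (θ ^ 2 + s * θ ^ 4) * Real.exp (-(s * θ ^ 2 / 3))
      ≤ 72 / s * Real.exp (-(s / 6) * θ ^ 2) := by
    have := add_sq_mul_exp_neg_le (y := s * θ ^ 2) (by positivity)
    have e : (θ ^ 2 + s * θ ^ 4) = (s * θ ^ 2 + (s * θ ^ 2) ^ 2) / s := by field_simp
    rw [e, div_mul_eq_mul_div, div_mul_eq_mul_div]
    refine div_le_div_of_nonneg_right (this.trans_eq ?_) hs0.le
    congr 2; ring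
  refine h1.trans (le_trans ?_ (add_le_add_right h2 _))
  rcases le_or_gt |θ| 1 with hθ1 | hθ1
  · have hc := (abs_le.mp (Real.cos_bound hθ1)).2
    have e4 : |θ| ^ 4 = θ ^ 4 := by rw [← abs_pow]; exact abs_of_nonneg (by positivity)
    rw [e4] at hc
    have hsq : θ ^ 2 ≤ 1 := by rw [← sq_abs]; nlinarith [abs_nonneg θ]
    -- `2s` times the error `5/96 · θ⁴` of `Real.cos_bound`.
    set x := 5 / 48 * s * θ ^ 4 with hx
    have hx0 : 0 ≤ x := by positivity
    have hxs : x ≤ s * θ ^ 4 := by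
      have : 0 ≤ s * θ ^ 4 := by positivity
      rw [hx]; nlinarith
    have hxs2 : x ≤ 5 / 48 * (s * θ ^ 2) := by
      have : s * θ ^ 4 ≤ s * θ ^ 2 := by
        have : θ ^ 4 ≤ θ ^ 2 := by nlinarith [sq_nonneg θ]
        gcongr
      rw [hx]; nlinarith
    have hb : -(2 * s * (1 - Real.cos θ)) ≤ -s * θ ^ 2 + x := by rw [hx]; nlinarith
    have hex : Real.exp x ≤ 1 + x * Real.exp x := by
      have h5 : Real.exp x * Real.exp (-x) = 1 := by rw [← Real.exp_add]; simp
      nlinarith [Real.add_one_le_exp (-x), Real.exp_pos x]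
    calc _ ≤ Real.exp (-s * θ ^ 2 + x) := Real.exp_le_exp.mpr hb
      _ = Real.exp (-s * θ ^ 2) * Real.exp x := Real.exp_add _ _
      _ ≤ Real.exp (-s * θ ^ 2) * (1 + x * Real.exp x) := by gcongr
      _ = Real.exp (-s * θ ^ 2) + x * Real.exp (-s * θ ^ 2 + x) := by rw [Real.exp_add]; ring
      _ ≤ _ := by
        gcongr
        · nlinarith [sq_nonneg θ]
        · nlinarith [mul_nonneg hs0.le (sq_nonneg θ)]
  -- Away from the origin crude decay suffices: the prefactor `θ² + s θ⁴` is at least `1` there.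
  · have hc := Real.cos_le_one_sub_mul_cos_sq hθ
    have hsq : 1 ≤ θ ^ 2 := by rw [← sq_abs]; nlinarith
    have hpi : 1 / 3 ≤ 4 / Real.pi ^ 2 := by
      rw [div_le_div_iff₀ (by norm_num) (by positivity)]
      nlinarith [Real.pi_lt_d2, Real.pi_pos]
    have hb : -(2 * s * (1 - Real.cos θ)) ≤ -(s * θ ^ 2 / 3) := by
      have : 1 / 3 * θ ^ 2 ≤ 4 / Real.pi ^ 2 * θ ^ 2 := by gcongr
      have : 1 / 3 * θ ^ 2 ≤ 2 * (1 - Real.cos θ) := by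
        have e : 4 / Real.pi ^ 2 * θ ^ 2 = 2 * (2 / Real.pi ^ 2 * θ ^ 2) := by ring
        linarith
      nlinarith
    have h6 : (1 : ℝ) ≤ θ ^ 2 + s * θ ^ 4 := by nlinarith [mul_nonneg hs0.le (sq_nonneg (θ ^ 2))]
    calc _ ≤ 1 * Real.exp (-(s * θ ^ 2 / 3)) := by
          rw [one_mul]; exact Real.exp_le_exp.mpr hb
      _ ≤ (θ ^ 2 + s * θ ^ 4) * Real.exp (-(s * θ ^ 2 / 3)) := by gcongr
      _ ≤ _ := le_add_of_nonneg_left (Real.exp_pos _).le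

/-- With `y = τ θ²`, `cos θ ≥ 1 - θ²/2` gives `lazyChar τ θ ≥ 1 - y ≥ exp(-y - y²)`; after `a` steps
the loss `a y²` is at most `τ a θ⁴`. -/
lemma lazyChar_pow_ge {τ : ℝ} (h0 : 0 < τ) (h : τ ≤ 1 / 4) {a : ℕ} (ha : 0 < a) {θ : ℝ}
    (hθ : |θ| ≤ 1) :
    Real.exp (-(τ * a) * θ ^ 2) * (1 - τ * a * θ ^ 4) ≤ lazyChar τ θ ^ a := by
  have ha' : (0 : ℝ) < a := by exact_mod_cast ha
  have hsq : θ ^ 2 ≤ 1 := by rw [← sq_abs]; nlinarith [abs_nonneg θ]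
  set y := τ * θ ^ 2 with hy
  have hy0 : 0 ≤ y := by positivity
  have hy1 : y ≤ 1 / 4 := by rw [hy]; nlinarith [sq_nonneg θ]
  have h1 : 1 - y ≤ lazyChar τ θ := by
    unfold lazyChar
    have := Real.one_sub_sq_div_two_le_cos (x := θ)
    rw [hy]; nlinarith
  have h2 : Real.exp (-y - y ^ 2) ≤ 1 - y := by
    have h3 := Real.quadratic_le_exp_of_nonneg (x := y + y ^ 2) (by positivity)
    have h4 : Real.exp (y + y ^ 2) * Real.exp (-y - y ^ 2) = 1 := by
      rw [← Real.exp_add]; ring_nf; simp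
    have h5 : 1 ≤ (1 - y) * Real.exp (y + y ^ 2) := by
      calc (1 : ℝ) ≤ (1 - y) * (1 + (y + y ^ 2) + (y + y ^ 2) ^ 2 / 2) := by
            have e : (1 - y) * (1 + (y + y ^ 2) + (y + y ^ 2) ^ 2 / 2) - 1
              = y ^ 2 * (1 / 2 - y / 2 - y ^ 2 / 2 - y ^ 3 / 2) := by ring
            have : 0 ≤ y ^ 2 * (1 / 2 - y / 2 - y ^ 2 / 2 - y ^ 3 / 2) := by
              apply mul_nonneg (by positivity)
              have h7 : y ^ 2 ≤ 1 / 4 := by nlinarith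
              have h8 : y ^ 3 ≤ 1 / 4 := by nlinarith
              linarith
            linarith
        _ ≤ _ := by gcongr; linarith
    nlinarith [Real.exp_pos (-y - y ^ 2)]
  calc _ ≤ Real.exp (-(τ * a) * θ ^ 2) * Real.exp (-(a * y ^ 2)) := by
        gcongr
        have : a * y ^ 2 ≤ τ * a * θ ^ 4 := by
          rw [hy]
          have : a * (τ * θ ^ 2) ^ 2 = τ * (τ * a * θ ^ 4) := by ring
          rw [this]
          have : 0 ≤ τ * a * θ ^ 4 := by positivity
          nlinarith
        linarith [Real.add_one_le_exp (-(a * y ^ 2))]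
    _ = Real.exp (-y - y ^ 2) ^ a := by
        rw [← Real.exp_add, ← Real.exp_nat_mul]; congr 1; rw [hy]; ring
    _ ≤ lazyChar τ θ ^ a := pow_le_pow_left₀ (Real.exp_pos _).le (h2.trans h1) a

lemma setIntegral_indicator_pi (F : ℝ → ℝ) :
    ∫ θ in -Real.pi..Real.pi, F θ = ∫ θ, (Set.Ioc (-Real.pi) Real.pi).indicator F θ := by
  rw [intervalIntegral.integral_of_le (by linarith [Real.pi_pos]),
    integral_indicator measurableSet_Ioc]

lemma integrable_indicator_pi {F : ℝ → ℝ} (hF : Continuous F) :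
    Integrable ((Set.Ioc (-Real.pi) Real.pi).indicator F) :=
  (integrable_indicator_iff measurableSet_Ioc).mpr
    ((hF.integrableOn_Icc (a := -Real.pi) (b := Real.pi)).mono_set Set.Ioc_subset_Icc_self)

theorem returnProb_le {τ : ℝ} (h0 : 0 < τ) (h : τ ≤ 1 / 4) {a : ℕ} (ha : 0 < a) :
    returnProb τ a ≤ (1 + 180 / (τ * a)) / (2 * √(Real.pi * (τ * a))) := by
  have ha' : (0 : ℝ) < a := by exact_mod_cast ha
  have hc := continuous_lazyChar τ
  have hs0 : 0 < τ * a := by positivity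
  have hpi := Real.pi_pos
  have hI1 := integrable_exp_neg_mul_sq hs0
  have hI2 := (integrable_exp_neg_mul_sq (b := τ * a / 6) (by positivity)).const_mul (72 / (τ * a))
  have key : ∫ θ in -Real.pi..Real.pi, lazyChar τ θ ^ a
      ≤ √(Real.pi / (τ * a)) + 72 / (τ * a) * √(Real.pi / (τ * a / 6)) := by
    rw [setIntegral_indicator_pi, ← integral_gaussian, ← integral_gaussian, ← integral_const_mul,
      ← integral_add hI1 hI2]
    refine integral_mono (integrable_indicator_pi (by fun_prop)) (hI1.add hI2) fun θ => ?_
    by_cases hθ : θ ∈ Set.Ioc (-Real.pi) Real.pi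
    · simp only [Set.indicator_of_mem hθ]
      exact lazyChar_pow_le h0 h ha (abs_le.mpr ⟨hθ.1.le, hθ.2⟩)
    · simp only [Set.indicator_of_notMem hθ]
      positivity
  unfold returnProb
  set s := τ * a
  have e1 : √(Real.pi / (s / 6)) = √6 * √(Real.pi / s) := by
    rw [← Real.sqrt_mul (by norm_num)]; congr 1; field_simp
  -- The constant `180` is `72 · 5/2`.
  have e6 : √6 ≤ 5 / 2 := by
    rw [Real.sqrt_le_left (by norm_num)]; norm_num
  have e2 : √(Real.pi / s) = Real.pi / √(Real.pi * s) := by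
    rw [Real.sqrt_div hpi.le, Real.sqrt_mul hpi.le, div_eq_div_iff (by positivity) (by positivity)]
    rw [← mul_assoc, Real.mul_self_sqrt hpi.le]
  calc _ ≤ (2 * Real.pi)⁻¹ * (√(Real.pi / s) + 72 / s * (5 / 2 * √(Real.pi / s))) := by
        gcongr
        refine key.trans ?_
        rw [e1]
        gcongr
    _ = _ := by
        rw [e2]
        have : √(Real.pi * s) ≠ 0 := by positivity
        field_simp
        ring

theorem returnProb_add_neighborProb_ge {τ : ℝ} (h0 : 0 < τ) (h : τ ≤ 1 / 4) {a : ℕ} (ha : 0 < a) :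
    (1 - 12 / (τ * a)) / √(Real.pi * (τ * a)) ≤ returnProb τ a + neighborProb τ a := by
  have ha' : (0 : ℝ) < a := by exact_mod_cast ha
  have hc := continuous_lazyChar τ
  have hs0 : 0 < τ * a := by positivity
  have hpi := Real.pi_pos
  have hI1 := (integrable_exp_neg_mul_sq hs0).const_mul 2
  have hI2 := (integrable_exp_neg_mul_sq (b := τ * a / 2) (by positivity)).const_mul (16 / (τ * a))
  have key : 2 * √(Real.pi / (τ * a)) - 16 / (τ * a) * √(Real.pi / (τ * a / 2))
      ≤ ∫ θ in -Real.pi..Real.pi, lazyChar τ θ ^ a * (1 + Real.cos θ) := by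
    rw [setIntegral_indicator_pi, ← integral_gaussian, ← integral_gaussian, ← integral_const_mul,
      ← integral_const_mul, ← integral_sub hI1 hI2]
    refine integral_mono (hI1.sub hI2) (integrable_indicator_pi (by fun_prop)) fun θ => ?_
    set s := τ * a with hs
    have h2 : (2 * θ ^ 2 + 2 * s * θ ^ 4) * Real.exp (-s * θ ^ 2)
        ≤ 16 / s * Real.exp (-(s / 2) * θ ^ 2) := by
      have := add_sq_mul_exp_neg_le' (y := s * θ ^ 2) (by positivity)
      have e : (2 * θ ^ 2 + 2 * s * θ ^ 4) = (2 * (s * θ ^ 2) + 2 * (s * θ ^ 2) ^ 2) / s := by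
        field_simp
      rw [e, div_mul_eq_mul_div, div_mul_eq_mul_div, neg_mul]
      refine div_le_div_of_nonneg_right (this.trans_eq ?_) hs0.le
      congr 2; ring
    have hE := Real.exp_pos (-s * θ ^ 2)
    have hnn : 0 ≤ (Set.Ioc (-Real.pi) Real.pi).indicator
        (fun θ => lazyChar τ θ ^ a * (1 + Real.cos θ)) θ :=
      Set.indicator_nonneg (fun θ _ => mul_nonneg (pow_nonneg (lazyChar_nonneg h0.le h θ) a)
        (by linarith [Real.neg_one_le_cos θ])) θ
    have h4 : 0 ≤ s * θ ^ 4 := by positivity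
    -- If `|θ| > 1` or `s θ⁴ ≥ 1`, the corrected Gaussian is nonpositive and the integrand
    -- nonnegative, so the Taylor bound is needed only in the remaining range.
    rcases le_or_gt |θ| 1 with hθ1 | hθ1
    · have hmem : θ ∈ Set.Ioc (-Real.pi) Real.pi := by
        have := abs_le.mp hθ1
        constructor <;> linarith [Real.pi_gt_three]
      rcases le_or_gt 1 (s * θ ^ 4) with h5 | h5
      · refine le_trans ?_ hnn
        nlinarith [sq_nonneg θ]
      · simp only [Set.indicator_of_mem hmem]
        have h6 := lazyChar_pow_ge h0 h ha hθ1
        rw [← hs] at h6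
        have h7 := Real.one_sub_sq_div_two_le_cos (x := θ)
        have hsq : θ ^ 2 ≤ 1 := by rw [← sq_abs]; nlinarith [abs_nonneg θ]
        have h8 : 0 ≤ 1 - s * θ ^ 4 := by linarith
        calc 2 * Real.exp (-s * θ ^ 2) - 16 / s * Real.exp (-(s / 2) * θ ^ 2)
            ≤ Real.exp (-s * θ ^ 2) * (2 - 2 * θ ^ 2 - 2 * (s * θ ^ 4)) := by nlinarith
          _ ≤ Real.exp (-s * θ ^ 2) * ((1 - s * θ ^ 4) * (2 - θ ^ 2 / 2)) := by
              gcongr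
              nlinarith [sq_nonneg θ, mul_nonneg h4 (sq_nonneg θ)]
          _ = Real.exp (-s * θ ^ 2) * (1 - s * θ ^ 4) * (2 - θ ^ 2 / 2) := by ring
          _ ≤ lazyChar τ θ ^ a * (1 + Real.cos θ) := by
              gcongr
              · nlinarith
              · exact pow_nonneg (lazyChar_nonneg h0.le h θ) a
              · linarith
    · refine le_trans ?_ hnn
      have hsq : 1 ≤ θ ^ 2 := by rw [← sq_abs]; nlinarith
      nlinarith
  have hsum : returnProb τ a + neighborProb τ a
      = (2 * Real.pi)⁻¹ * ∫ θ in -Real.pi..Real.pi, lazyChar τ θ ^ a * (1 + Real.cos θ) := by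
    unfold returnProb neighborProb
    rw [← mul_add, ← intervalIntegral.integral_add
      (Continuous.intervalIntegrable (by fun_prop) _ _)
      (Continuous.intervalIntegrable (by fun_prop) _ _)]
    simp only [mul_add, mul_one]
  rw [hsum]
  set s := τ * a
  have e1 : √(Real.pi / (s / 2)) = √2 * √(Real.pi / s) := by
    rw [← Real.sqrt_mul (by norm_num)]; congr 1; field_simp
  have e6 : √2 ≤ 3 / 2 := by
    rw [Real.sqrt_le_left (by norm_num)]; norm_num
  have e2 : √(Real.pi / s) = Real.pi / √(Real.pi * s) := by
    rw [Real.sqrt_div hpi.le, Real.sqrt_mul hpi.le, div_eq_div_iff (by positivity) (by positivity)]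
    rw [← mul_assoc, Real.mul_self_sqrt hpi.le]
  calc _ = (2 * Real.pi)⁻¹ * (2 * √(Real.pi / s) - 16 / s * (3 / 2 * √(Real.pi / s))) := by
        rw [e2]
        have : √(Real.pi * s) ≠ 0 := by positivity
        field_simp
        ring
    _ ≤ _ := by
        gcongr
        refine le_trans ?_ key
        rw [e1]
        gcongr

lemma one_le_one_sub_mul_exp {x : ℝ} (h0 : 0 ≤ x) (h : x ≤ 1 / 2) :
    1 ≤ (1 - x) * Real.exp (2 * x) := by
  have h3 := Real.quadratic_le_exp_of_nonneg (x := 2 * x) (by positivity)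
  calc (1 : ℝ) ≤ (1 - x) * (1 + 2 * x + (2 * x) ^ 2 / 2) := by nlinarith
    _ ≤ _ := by gcongr; linarith

/-- The pair probability of two sign vectors is close to the square of the single one. -/
theorem two_mul_returnProb_mul_returnProb_le {τ : ℝ} (h0 : 0 < τ) (h : τ ≤ 1 / 4) {a b k : ℕ}
    (hab : a + b = k) (ha : k ≤ 4 * a) (hb : k ≤ 4 * b) (hk : 24 ≤ τ * k) :
    2 * (returnProb τ a * returnProb τ b) ≤ (returnProb τ k + neighborProb τ k) ^ 2
      * Real.exp ((((a : ℝ) - b) / k) ^ 2 + 1488 / (τ * k)) := by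
  have hk0 : 0 < k := by
    rcases Nat.eq_zero_or_pos k with rfl | h
    · norm_num at hk
    · exact h
  have ha0 : 0 < a := by omega
  have hb0 : 0 < b := by omega
  have ha' : (0 : ℝ) < a := by exact_mod_cast ha0
  have hb' : (0 : ℝ) < b := by exact_mod_cast hb0
  have hk' : (0 : ℝ) < k := by exact_mod_cast hk0
  have hab' : (a : ℝ) + b = k := by exact_mod_cast hab
  have ha4 : (k : ℝ) ≤ 4 * a := by exact_mod_cast ha
  have hb4 : (k : ℝ) ≤ 4 * b := by exact_mod_cast hb
  have hpi := Real.pi_pos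
  set s := τ * k with hs
  have hs0 : 0 < s := by positivity
  set q := returnProb τ k + neighborProb τ k with hq
  -- `720 = 4 · 180`, because `a` and `b` are at least `k/4`.
  have hexp : ∀ c : ℕ, (k : ℝ) ≤ 4 * c → (0 : ℝ) < c → 1 + 180 / (τ * c) ≤ Real.exp (720 / s) := by
    intro c hc hc0
    have : 180 / (τ * c) ≤ 720 / s := by
      rw [div_le_div_iff₀ (by positivity) hs0, hs]
      nlinarith
    linarith [Real.add_one_le_exp (720 / s)]
  have hA : returnProb τ a ≤ Real.exp (720 / s) / (2 * √(Real.pi * (τ * a))) :=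
    (returnProb_le h0 h ha0).trans (by gcongr; exact hexp a ha4 ha')
  have hB : returnProb τ b ≤ Real.exp (720 / s) / (2 * √(Real.pi * (τ * b))) :=
    (returnProb_le h0 h hb0).trans (by gcongr; exact hexp b hb4 hb')
  have hQ : Real.exp (-(24 / s)) / √(Real.pi * s) ≤ q := by
    refine le_trans ?_ (returnProb_add_neighborProb_ge h0 h hk0)
    rw [← hs]
    gcongr
    have hx : 12 / s ≤ 1 / 2 := by rw [div_le_div_iff₀ hs0 (by norm_num)]; linarith
    have h1 := one_le_one_sub_mul_exp (x := 12 / s) (by positivity) hx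
    have h2 : 2 * (12 / s) = 24 / s := by ring
    rw [h2] at h1
    have h4 : Real.exp (24 / s) * Real.exp (-(24 / s)) = 1 := by rw [← Real.exp_add]; simp
    nlinarith [Real.exp_pos (-(24 / s))]
  have hQ2 : Real.exp (-(48 / s)) / (Real.pi * s) ≤ q ^ 2 := by
    calc _ = (Real.exp (-(24 / s)) / √(Real.pi * s)) ^ 2 := by
          rw [div_pow, Real.sq_sqrt (by positivity), ← Real.exp_nat_mul]
          congr 2; push_cast; ring
      _ ≤ q ^ 2 := by gcongr
  set x := (((a : ℝ) - b) / k) ^ 2 with hx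
  have h4ab : 4 * (a * b : ℝ) = k ^ 2 * (1 - x) := by
    rw [hx, ← hab']; field_simp; ring
  have hx0 : 0 ≤ x := by positivity
  have hx1 : x ≤ 1 / 2 := by
    have : k ^ 2 * (1 - x) ≥ k ^ 2 * (3 / 4 : ℝ) := by rw [← h4ab]; nlinarith
    have := le_of_mul_le_mul_left this (by positivity)
    linarith
  -- This is `1/√(1-x) ≤ exp x`, since `4ab = k²(1-x)`.
  have hroot : (k : ℝ) ≤ 2 * √(a * b) * Real.exp x := by
    apply le_of_sq_le_sq _ (by positivity)
    rw [mul_pow, mul_pow, Real.sq_sqrt (by positivity), ← Real.exp_nat_mul]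
    have := one_le_one_sub_mul_exp hx0 hx1
    push_cast
    calc (k : ℝ) ^ 2 ≤ k ^ 2 * ((1 - x) * Real.exp (2 * x)) := le_mul_of_one_le_right (by positivity) this
      _ = _ := by rw [← mul_assoc, ← h4ab]; ring
  calc 2 * (returnProb τ a * returnProb τ b)
      ≤ 2 * (Real.exp (720 / s) / (2 * √(Real.pi * (τ * a)))
        * (Real.exp (720 / s) / (2 * √(Real.pi * (τ * b))))) := by
        have := returnProb_nonneg h0.le h b
        gcongr
    _ = Real.exp (1440 / s) * (1 / (2 * (Real.pi * τ) * √(a * b))) := by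
        have e1 : Real.exp (1440 / s) = Real.exp (720 / s) * Real.exp (720 / s) := by
          rw [← Real.exp_add]; congr 1; ring
        rw [e1, ← mul_assoc Real.pi, ← mul_assoc Real.pi, Real.sqrt_mul (by positivity),
          Real.sqrt_mul (by positivity) (b : ℝ), Real.sqrt_mul ha'.le]
        have e2 : √(Real.pi * τ) * √(Real.pi * τ) = Real.pi * τ := Real.mul_self_sqrt (by positivity)
        have : √(Real.pi * τ) ≠ 0 := by positivity
        have : √(a : ℝ) ≠ 0 := by positivity
        have : √(b : ℝ) ≠ 0 := by positivity
        field_simp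
        rw [Real.sq_sqrt (by positivity)]
    _ ≤ Real.exp (1440 / s) * (Real.exp x / (Real.pi * s)) := by
        refine mul_le_mul_of_nonneg_left ?_ (Real.exp_pos _).le
        rw [div_le_div_iff₀ (by positivity) (by positivity), hs]
        nlinarith [mul_le_mul_of_nonneg_left hroot (by positivity : 0 ≤ Real.pi * τ)]
    -- `1488 = 1440 + 48`: the upper error for both walks, plus the loss in the lower bound for
    -- `q²`.
    _ = Real.exp (-(48 / s)) / (Real.pi * s) * Real.exp (x + 1488 / s) := by
        rw [mul_div_assoc', div_mul_eq_mul_div, ← Real.exp_add, ← Real.exp_add]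
        congr 2; ring
    _ ≤ _ := by gcongr

/-! ### Gaussian linearisation of a squared sign sum -/

/-- Exponential square moment of a sum of `k` independent random signs. -/
theorem sum_exp_sq_sum_sign_le {k : ℕ} {c : ℝ} (hc : 0 ≤ c) (hck : 2 * c * k < 1) :
    ∑ δ : Fin k → ℤˣ, Real.exp (c * (∑ j, ((δ j : ℤ) : ℝ)) ^ 2)
      ≤ 2 ^ k / √(1 - 2 * c * k) := by
  have hpi := Real.pi_pos
  have hsum : ∀ t : ℝ, ∑ δ : Fin k → ℤˣ, Real.exp (t * ∑ j, ((δ j : ℤ) : ℝ))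
      = (2 * Real.cosh t) ^ k := by
    intro t
    have := Finset.prod_univ_sum (fun _ : Fin k => (Finset.univ : Finset ℤˣ))
      (fun _ x => Real.exp (t * ((x : ℤ) : ℝ)))
    rw [Fintype.piFinset_univ] at this
    simp only [Finset.mul_sum, Real.exp_sum]
    rw [← this, Finset.prod_const, Finset.card_univ, Fintype.card_fin]
    congr 1
    rw [Real.cosh_eq, UnitsInt.univ, Finset.sum_pair (by decide)]
    simp; ring
  -- Writing `exp(c S²)` as a Gaussian average of exponentials linear in `S` makes the sum over
  -- signs factor into a power of `cosh`.
  have hgauss : ∀ S : ℝ, √Real.pi * Real.exp (c * S ^ 2)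
      = ∫ x : ℝ, Real.exp (-1 * x ^ 2) * Real.exp (2 * √c * x * S) := by
    intro S
    have h1 : ∀ x : ℝ, Real.exp (-1 * x ^ 2) * Real.exp (2 * √c * x * S)
        = Real.exp (c * S ^ 2) * Real.exp (-1 * (x - √c * S) ^ 2) := by
      intro x
      rw [← Real.exp_add, ← Real.exp_add]
      congr 1
      nlinarith [Real.mul_self_sqrt hc]
    simp_rw [h1]
    rw [integral_const_mul, integral_sub_right_eq_self (fun x : ℝ => Real.exp (-1 * x ^ 2)),
      integral_gaussian, div_one, mul_comm]
  have hint : ∀ S : ℝ, Integrable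
      (fun x : ℝ => Real.exp (-1 * x ^ 2) * Real.exp (2 * √c * x * S)) := by
    intro S
    -- A non-integrable function would have integral `0`, but `hgauss` gives a positive value.
    by_contra hn
    have := hgauss S
    rw [integral_undef hn] at this
    have h2 : 0 < √Real.pi * Real.exp (c * S ^ 2) := by positivity
    linarith
  have hsp : 0 < √Real.pi := by positivity
  have hb : 0 < 1 - 2 * c * k := by linarith
  rw [← mul_le_mul_iff_right₀ hsp, Finset.mul_sum]
  simp_rw [hgauss]
  rw [← integral_finsetSum _ (fun δ _ => hint _)]
  calc _ ≤ ∫ x : ℝ, 2 ^ k * Real.exp (-(1 - 2 * c * k) * x ^ 2) := by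
        refine integral_mono (integrable_finsetSum _ fun δ _ => hint _)
          ((integrable_exp_neg_mul_sq hb).const_mul _) fun x => ?_
        simp only
        rw [← Finset.mul_sum, hsum, mul_pow]
        calc _ ≤ Real.exp (-1 * x ^ 2) * (2 ^ k * Real.exp ((2 * √c * x) ^ 2 / 2) ^ k) := by
              gcongr
              · exact Real.cosh_le_exp_half_sq _
          _ = _ := by
              rw [← Real.exp_nat_mul, mul_left_comm, ← Real.exp_add]
              have h2 : (2 * √c * x) ^ 2 = 4 * c * x ^ 2 := by
                rw [mul_pow, mul_pow, Real.sq_sqrt hc]; ring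
              rw [h2]
              congr 2
              ring
    _ = √Real.pi * (2 ^ k / √(1 - 2 * c * k)) := by
        rw [integral_const_mul, integral_gaussian, Real.sqrt_div hpi.le]
        ring

/-! ### Finite product weights -/

/-- The weights of the Bernoulli distribution with parameter `p`. -/
def bernWeight (p : ℝ) (b : Bool) : ℝ := if b then p else 1 - p

/-- The weight of a vector of independent Bernoulli bits. -/
def rowWeight {ι : Type*} [Fintype ι] (p : ℝ) (r : ι → Bool) : ℝ := ∏ i, bernWeight p (r i)

lemma bernWeight_nonneg {p : ℝ} (h0 : 0 ≤ p) (h1 : p ≤ 1) (b : Bool) : 0 ≤ bernWeight p b := by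
  cases b <;> simp [bernWeight, h0, h1]

lemma rowWeight_nonneg {ι : Type*} [Fintype ι] {p : ℝ} (h0 : 0 ≤ p) (h1 : p ≤ 1)
    (r : ι → Bool) : 0 ≤ rowWeight p r :=
  Finset.prod_nonneg fun _ _ => bernWeight_nonneg h0 h1 _

lemma sum_prod_apply {ι κ R : Type*} [Fintype ι] [DecidableEq ι] [Fintype κ] [CommSemiring R]
    (F : ι → κ → R) : ∑ r : ι → κ, ∏ i, F i (r i) = ∏ i, ∑ x, F i x := by
  rw [Finset.prod_univ_sum, Fintype.piFinset_univ]

lemma sum_rowWeight {ι : Type*} [Fintype ι] [DecidableEq ι] (p : ℝ) :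
    ∑ r : ι → Bool, rowWeight p r = 1 := by
  unfold rowWeight
  rw [sum_prod_apply (fun _ b => bernWeight p b)]
  simp [bernWeight]

lemma sum_prod_mul_prod {m : ℕ} {R : Type*} [Fintype R] (w G : R → ℝ) :
    ∑ M : Fin m → R, (∏ i, w (M i)) * ∏ i, G (M i) = (∑ r, w r * G r) ^ m := by
  simp_rw [← Finset.prod_mul_distrib]
  rw [sum_prod_apply (fun _ r => w r * G r)]
  simp

open Classical in
/-- The second moment method for the existence of an `e : E` all of whose conditions
`S e (M i)` hold, where the `M i` are independent with weights `w`. -/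
theorem second_moment {m : ℕ} {R E : Type*} [Fintype R] [Fintype E] (w : R → ℝ)
    (hw : ∀ r, 0 ≤ w r) (S : E → R → Prop) :
    (∑ e, (∑ r, w r * if S e r then 1 else 0) ^ m) ^ 2
      ≤ (∑ M : Fin m → R, (∏ i, w (M i)) * if ∃ e, ∀ i, S e (M i) then 1 else 0)
        * ∑ e, ∑ e', (∑ r, w r * if S e r ∧ S e' r then 1 else 0) ^ m := by
  have hprod : ∀ (T : R → Prop) (M : Fin m → R),
      ∏ i, (if T (M i) then (1 : ℝ) else 0) = if ∀ i, T (M i) then 1 else 0 := by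
    intro T M
    rw [Finset.prod_ite_zero]; simp
  set Z : (Fin m → R) → ℝ := fun M => ∑ e, if ∀ i, S e (M i) then 1 else 0 with hZ
  have hW : ∀ M : Fin m → R, 0 ≤ ∏ i, w (M i) := fun M => Finset.prod_nonneg fun i _ => hw _
  have h1 : ∑ e, (∑ r, w r * if S e r then (1 : ℝ) else 0) ^ m
      = ∑ M : Fin m → R, (∏ i, w (M i)) * Z M := by
    simp_rw [← sum_prod_mul_prod, hprod, hZ, Finset.mul_sum]
    exact Finset.sum_comm
  have h2 : ∑ e, ∑ e', (∑ r, w r * if S e r ∧ S e' r then (1 : ℝ) else 0) ^ m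
      = ∑ M : Fin m → R, (∏ i, w (M i)) * Z M ^ 2 := by
    simp_rw [hZ, sq, Finset.sum_mul_sum, Finset.mul_sum]
    conv_rhs => rw [Finset.sum_comm]
    refine Finset.sum_congr rfl fun e _ => ?_
    conv_rhs => rw [Finset.sum_comm]
    refine Finset.sum_congr rfl fun e' _ => ?_
    rw [← sum_prod_mul_prod w (fun r => if S e r ∧ S e' r then (1 : ℝ) else 0)]
    refine Finset.sum_congr rfl fun M _ => ?_
    rw [← hprod (S e), ← hprod (S e')]
    refine congrArg _ (Eq.trans (Finset.prod_congr rfl fun i _ => ?_) Finset.prod_mul_distrib)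
    rw [ite_and, ite_mul, one_mul, zero_mul]
  rw [h1, h2]
  -- Cauchy–Schwarz applied to `Z` times the indicator that some `e` works, which equals `Z`.
  refine Finset.sum_sq_le_sum_mul_sum_of_sq_le_mul _ (fun M _ => ?_) (fun M _ => ?_)
    fun M _ => le_of_eq ?_
  · exact mul_nonneg (hW M) (by split_ifs <;> norm_num)
  · exact mul_nonneg (hW M) (sq_nonneg _)
  · split_ifs with h
    · ring
    · have : Z M = 0 := Finset.sum_eq_zero fun e _ => by
        rw [if_neg]; exact fun he => h ⟨e, he⟩
      simp [this]

/-! ### Paired columns -/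

/-- Column `2 j + b` of a matrix with `n` columns, for `j < n / 2`. -/
def pairIdx {n : ℕ} (x : Fin (n / 2) × Bool) : Fin n :=
  ⟨2 * x.1 + x.2.toNat, by have := x.1.2; have := Bool.toNat_le x.2; omega⟩

lemma pairIdx_injective {n : ℕ} : Function.Injective (pairIdx (n := n)) := by
  rintro ⟨i, a⟩ ⟨j, b⟩ h
  have h' : 2 * (i : ℕ) + a.toNat = 2 * j + b.toNat := congrArg Fin.val h
  have hij : (i : ℕ) = j := by have := Bool.toNat_le a; have := Bool.toNat_le b; omega
  have hab : a.toNat = b.toNat := by omega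
  have : a = b := by cases a <;> cases b <;> simp_all
  rw [Fin.ext hij, this]

/-- The vector taking the value `y j` at the column `2 j + 1`, the value `-y j` at the column
`2 j`, and `c` at the last column, if it has no partner. -/
noncomputable def pairVec {R : Type*} [Neg R] {n : ℕ} (y : Fin (n / 2) → R) (c : R) : Fin n → R :=
  Function.extend pairIdx (fun x => if x.2 then y x.1 else -y x.1) (fun _ => c)

/-- The differences of the paired columns of a row of bits. -/
def pairDiff {n : ℕ} (r : Fin n → Bool) (j : Fin (n / 2)) : ℤ :=
  (r (pairIdx (j, true))).toNat - (r (pairIdx (j, false))).toNat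

lemma pairVec_pairIdx {R : Type*} [Neg R] {n : ℕ} (y : Fin (n / 2) → R) (c : R)
    (x : Fin (n / 2) × Bool) : pairVec y c (pairIdx x) = if x.2 then y x.1 else -y x.1 :=
  pairIdx_injective.extend_apply _ _ _

lemma pairVec_of_notMem {R : Type*} [Neg R] {n : ℕ} (y : Fin (n / 2) → R) (c : R)
    {i : Fin n} (hi : i ∉ Set.range (pairIdx (n := n))) : pairVec y c i = c :=
  Function.extend_apply' _ _ _ (by simpa using hi)

lemma sum_pairVec_mul {n : ℕ} (y : Fin (n / 2) → ℝ) (r : Fin n → Bool) :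
    ∑ i, pairVec y 0 i * ((r i).toNat : ℝ) = ∑ j, y j * pairDiff r j := by
  rw [← Fintype.sum_of_injective pairIdx pairIdx_injective
    (fun x => pairVec y 0 (pairIdx x) * ((r (pairIdx x)).toNat : ℝ)) _
    (fun i hi => by rw [pairVec_of_notMem y 0 hi, zero_mul]) (fun _ => rfl),
    Fintype.sum_prod_type]
  refine Finset.sum_congr rfl fun j _ => ?_
  simp [pairVec_pairIdx, pairDiff]
  ring

/-- The characteristic function of the vector of paired differences. -/
theorem sum_rowWeight_mul_cexp {n : ℕ} (p : ℝ) (y : Fin (n / 2) → ℝ) :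
    ∑ r : Fin n → Bool, (rowWeight p r : ℂ) * Complex.exp (((∑ j, y j * pairDiff r j : ℝ) : ℂ)
      * Complex.I) = ∏ j, (lazyChar (p * (1 - p)) (y j) : ℂ) := by
  have h1 : ∀ r : Fin n → Bool, (rowWeight p r : ℂ) *
      Complex.exp (((∑ j, y j * pairDiff r j : ℝ) : ℂ) * Complex.I)
      = ∏ i, ((bernWeight p (r i) : ℂ) *
        Complex.exp ((pairVec y 0 i * ((r i).toNat : ℝ) : ℝ) * Complex.I)) := by
    intro r
    rw [← sum_pairVec_mul, Finset.prod_mul_distrib, ← Complex.exp_sum, rowWeight]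
    push_cast
    rw [Finset.sum_mul]
  simp_rw [h1]
  rw [sum_prod_apply (fun i b => (bernWeight p b : ℂ) *
        Complex.exp ((pairVec y 0 i * ((b.toNat : ℕ) : ℝ) : ℝ) * Complex.I))]
  -- An unpaired column has phase `0`, so its factor is `p + (1 - p) = 1`.
  rw [← Fintype.prod_of_injective pairIdx pairIdx_injective
    (fun x => ∑ b : Bool, (bernWeight p b : ℂ) *
        Complex.exp ((pairVec y 0 (pairIdx x) * ((b.toNat : ℕ) : ℝ) : ℝ) * Complex.I)) _
    (fun i hi => by rw [pairVec_of_notMem y 0 hi]; simp [bernWeight]) (fun _ => rfl),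
    Fintype.prod_prod_type]
  refine Finset.prod_congr rfl fun j _ => ?_
  -- A pair contributes `|1 - p + p exp(iy)|² = 1 - 2p(1-p)(1 - cos y)`.
  simp only [Fintype.prod_bool, pairVec_pairIdx, Fintype.sum_bool, bernWeight, lazyChar]
  simp only [if_true, Bool.false_eq_true, if_false, Bool.toNat_true, Bool.toNat_false,
    Nat.cast_one, Nat.cast_zero, mul_one, mul_zero, Complex.ofReal_zero, zero_mul, Complex.exp_zero]
  have hs := Complex.sin_sq_add_cos_sq (y j : ℂ)
  push_cast
  rw [Complex.exp_mul_I, Complex.exp_mul_I, Complex.cos_neg, Complex.sin_neg]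
  linear_combination (p : ℂ) ^ 2 * hs + (-(p : ℂ) ^ 2 * Complex.sin (y j) ^ 2) * (Complex.I_sq)

/-- The mean of a shifted cosine of a combination of paired differences. -/
theorem sum_rowWeight_mul_cos {n : ℕ} (p : ℝ) (y : Fin (n / 2) → ℝ) (c : ℝ) :
    ∑ r : Fin n → Bool, rowWeight p r * Real.cos (∑ j, y j * pairDiff r j + c)
      = Real.cos c * ∏ j, lazyChar (p * (1 - p)) (y j) := by
  have h := congrArg (fun z => (z * Complex.exp (c * Complex.I)).re)
    (sum_rowWeight_mul_cexp (n := n) p y)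
  simp only [Finset.sum_mul, Complex.re_sum] at h
  rw [← Complex.ofReal_prod, Complex.re_ofReal_mul, Complex.exp_ofReal_mul_I_re] at h
  rw [mul_comm, ← h]
  refine Finset.sum_congr rfl fun r _ => ?_
  rw [mul_assoc, ← Complex.exp_add, ← add_mul, ← Complex.ofReal_add, Complex.re_ofReal_mul,
    Complex.exp_ofReal_mul_I_re]

lemma inv_two_pi_mul_integral_cos (N : ℤ) :
    (2 * Real.pi)⁻¹ * ∫ θ in -Real.pi..Real.pi, Real.cos (θ * N) = if N = 0 then 1 else 0 := by
  split_ifs with h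
  · subst h
    simp
    field_simp
    ring
  · have hN : (N : ℝ) ≠ 0 := by exact_mod_cast h
    rw [intervalIntegral.integral_comp_mul_right (fun x => Real.cos x) hN, integral_cos]
    have := Real.sin_int_mul_pi N
    rw [mul_comm] at this
    simp [this]

/-- The joint law of the walks over a set `J` of pairs and over its complement. -/
theorem sum_rowWeight_split {n : ℕ} (p : ℝ) (ε : Fin (n / 2) → ℤˣ) (J : Finset (Fin (n / 2)))
    (t : ℤ) :
    ∑ r : Fin n → Bool, rowWeight p r *
      ((if ∑ j ∈ J, (ε j : ℤ) * pairDiff r j = 0 then 1 else 0) *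
        (if ∑ j ∈ Jᶜ, (ε j : ℤ) * pairDiff r j = -t then 1 else 0))
    = returnProb (p * (1 - p)) J.card * ((2 * Real.pi)⁻¹ * ∫ η in -Real.pi..Real.pi,
        lazyChar (p * (1 - p)) η ^ Jᶜ.card * Real.cos (η * t)) := by
  set τ := p * (1 - p)
  have hc := continuous_lazyChar τ
  have hcos : ∀ (s : ℤˣ) (x : ℝ), lazyChar τ (x * ((s : ℤ) : ℝ)) = lazyChar τ x := by
    intro s x
    rcases Int.units_eq_one_or s with rfl | rfl <;> simp [lazyChar]
  -- The product of cosines is the mean of `cos(A + B)` and `cos(-A + B)`; both have the same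
  -- expectation because `lazyChar` is even.
  have hE : ∀ θ η : ℝ, ∑ r : Fin n → Bool, rowWeight p r *
      (Real.cos (θ * (∑ j ∈ J, (ε j : ℤ) * pairDiff r j : ℤ)) *
        Real.cos (η * (∑ j ∈ Jᶜ, (ε j : ℤ) * pairDiff r j + t : ℤ)))
      = lazyChar τ θ ^ J.card * (lazyChar τ η ^ Jᶜ.card * Real.cos (η * t)) := by
    intro θ η
    have hplus : ∀ θ : ℝ, ∑ r : Fin n → Bool, rowWeight p r *
        Real.cos (θ * (∑ j ∈ J, (ε j : ℤ) * pairDiff r j : ℤ)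
          + η * (∑ j ∈ Jᶜ, (ε j : ℤ) * pairDiff r j + t : ℤ))
        = lazyChar τ θ ^ J.card * (lazyChar τ η ^ Jᶜ.card * Real.cos (η * t)) := by
      intro θ
      have h := sum_rowWeight_mul_cos (n := n) p
        (fun j => (if j ∈ J then θ else η) * ((ε j : ℤ) : ℝ)) (η * t)
      have hprod : ∏ j, lazyChar τ ((if j ∈ J then θ else η) * ((ε j : ℤ) : ℝ))
          = lazyChar τ θ ^ J.card * lazyChar τ η ^ Jᶜ.card := by
        simp_rw [hcos]
        rw [← Finset.prod_mul_prod_compl J, ← Finset.prod_const, ← Finset.prod_const]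
        congr 1
        · exact Finset.prod_congr rfl fun j hj => by rw [if_pos hj]
        · exact Finset.prod_congr rfl fun j hj => by rw [if_neg (Finset.mem_compl.mp hj)]
      rw [hprod] at h
      rw [← mul_assoc, mul_comm _ (Real.cos _), ← h]
      refine Finset.sum_congr rfl fun r _ => ?_
      congr 2
      rw [← Finset.sum_add_sum_compl J]
      push_cast
      rw [mul_add, ← add_assoc, Finset.mul_sum, Finset.mul_sum]
      congr 2
      · exact Finset.sum_congr rfl fun j hj => by rw [if_pos hj]; ring
      · exact Finset.sum_congr rfl fun j hj => by rw [if_neg (Finset.mem_compl.mp hj)]; ring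
    have h1 := hplus θ
    have h2 := hplus (-θ)
    have e : lazyChar τ (-θ) = lazyChar τ θ := by simp [lazyChar]
    rw [e] at h2
    have h3 := congrArg₂ (· + ·) h1 h2
    simp only [← Finset.sum_add_distrib, ← mul_add] at h3
    have h4 : ∀ A B : ℝ, Real.cos A * Real.cos B
        = (Real.cos (A + B) + Real.cos (-A + B)) / 2 := by
      intro A B
      rw [Real.cos_add, Real.cos_add, Real.cos_neg, Real.sin_neg]; ring
    simp_rw [h4, mul_div_assoc', ← Finset.sum_div]
    simp only [neg_mul] at h3
    rw [h3]; ring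
  -- Fourier inversion of both indicators at once.
  have hind : ∀ r : Fin n → Bool, rowWeight p r *
      ((if ∑ j ∈ J, (ε j : ℤ) * pairDiff r j = 0 then (1 : ℝ) else 0) *
        (if ∑ j ∈ Jᶜ, (ε j : ℤ) * pairDiff r j = -t then 1 else 0))
      = (2 * Real.pi)⁻¹ * ((2 * Real.pi)⁻¹ * ∫ θ in -Real.pi..Real.pi, ∫ η in -Real.pi..Real.pi,
        rowWeight p r *
      (Real.cos (θ * (∑ j ∈ J, (ε j : ℤ) * pairDiff r j : ℤ)) *
        Real.cos (η * (∑ j ∈ Jᶜ, (ε j : ℤ) * pairDiff r j + t : ℤ)))) := by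
    intro r
    simp_rw [eq_neg_iff_add_eq_zero, ← inv_two_pi_mul_integral_cos,
      intervalIntegral.integral_const_mul, intervalIntegral.integral_mul_const]
    ring
  simp_rw [hind]
  rw [← Finset.mul_sum, ← Finset.mul_sum, ← intervalIntegral.integral_finsetSum]
  · have : ∀ θ : ℝ, ∑ r : Fin n → Bool, ∫ η in -Real.pi..Real.pi, rowWeight p r *
      (Real.cos (θ * (∑ j ∈ J, (ε j : ℤ) * pairDiff r j : ℤ)) *
        Real.cos (η * (∑ j ∈ Jᶜ, (ε j : ℤ) * pairDiff r j + t : ℤ)))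
        = lazyChar τ θ ^ J.card * ∫ η in -Real.pi..Real.pi,
          lazyChar τ η ^ Jᶜ.card * Real.cos (η * t) := by
      intro θ
      rw [← intervalIntegral.integral_finsetSum]
      · simp_rw [hE θ, intervalIntegral.integral_const_mul]
      · intro r _
        exact Continuous.intervalIntegrable (by fun_prop) _ _
    simp_rw [this, intervalIntegral.integral_mul_const, returnProb]
    ring
  · intro r _
    simp_rw [intervalIntegral.integral_const_mul]
    exact Continuous.intervalIntegrable (by fun_prop) _ _

/-- The combination of paired differences with signs `ε`, asked to be `0` or `-1`. -/
def NearZero {n : ℕ} (ε : Fin (n / 2) → ℤˣ) (r : Fin n → Bool) : Prop :=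
  ∑ j, (ε j : ℤ) * pairDiff r j = 0 ∨ ∑ j, (ε j : ℤ) * pairDiff r j = -1

instance {n : ℕ} (ε : Fin (n / 2) → ℤˣ) (r : Fin n → Bool) : Decidable (NearZero ε r) :=
  inferInstanceAs (Decidable (_ ∨ _))

lemma sum_rowWeight_split_zero_or {n : ℕ} (p : ℝ) (ε : Fin (n / 2) → ℤˣ)
    (J : Finset (Fin (n / 2))) :
    ∑ r : Fin n → Bool, rowWeight p r *
      (if ∑ j ∈ J, (ε j : ℤ) * pairDiff r j = 0 ∧ (∑ j ∈ Jᶜ, (ε j : ℤ) * pairDiff r j = 0 ∨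
        ∑ j ∈ Jᶜ, (ε j : ℤ) * pairDiff r j = -1) then 1 else 0)
    = returnProb (p * (1 - p)) J.card * (returnProb (p * (1 - p)) Jᶜ.card
      + neighborProb (p * (1 - p)) Jᶜ.card) := by
  have h0 := sum_rowWeight_split p ε J 0
  have h1 := sum_rowWeight_split p ε J 1
  simp only [Int.cast_zero, mul_zero, Real.cos_zero, mul_one, neg_zero, Int.cast_one] at h0 h1
  rw [mul_add, returnProb, returnProb, neighborProb, ← returnProb, ← h0, ← h1,
    ← Finset.sum_add_distrib]
  refine Finset.sum_congr rfl fun r _ => ?_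
  rw [← mul_add]
  congr 1
  by_cases hT : ∑ j ∈ J, (ε j : ℤ) * pairDiff r j = 0
  · by_cases hS : ∑ j ∈ Jᶜ, (ε j : ℤ) * pairDiff r j = 0
    · simp [hT, hS]
    · by_cases hS1 : ∑ j ∈ Jᶜ, (ε j : ℤ) * pairDiff r j = -1 <;> simp [hT, hS, hS1]
  · simp [hT]

lemma returnProb_zero (τ : ℝ) : returnProb τ 0 = 1 := by
  simp [returnProb]; field_simp; ring

theorem sum_rowWeight_nearZero {n : ℕ} (p : ℝ) (ε : Fin (n / 2) → ℤˣ) :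
    ∑ r : Fin n → Bool, rowWeight p r * (if NearZero ε r then 1 else 0)
      = returnProb (p * (1 - p)) (n / 2) + neighborProb (p * (1 - p)) (n / 2) := by
  have := sum_rowWeight_split_zero_or p ε ∅
  simp only [Finset.sum_empty, true_and, Finset.compl_empty, Finset.card_empty, Finset.card_univ,
    Fintype.card_fin, returnProb_zero, one_mul] at this
  exact this

/-- Let `S`, `T` be the sums over the differing and the agreeing positions. The two walks are `S +
T` and `-S + T`. Both lie in `{0, -1}`, so `2S` has absolute value at most `1`; hence `S = 0` and
`T` is in the window. The factor `2` comes from bounding the probability of `-1` by that of `0`. -/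
theorem sum_rowWeight_nearZero_and_le {n : ℕ} {p : ℝ} (h0 : 0 ≤ p) (h1 : p ≤ 1)
    (ε ε' : Fin (n / 2) → ℤˣ) :
    ∑ r : Fin n → Bool, rowWeight p r * (if NearZero ε r ∧ NearZero ε' r then 1 else 0)
      ≤ 2 * (returnProb (p * (1 - p)) (Finset.univ.filter fun j => ε j = ε' j).card *
        returnProb (p * (1 - p)) (Finset.univ.filter fun j => ε j ≠ ε' j).card) := by
  set J := Finset.univ.filter fun j => ε j ≠ ε' j with hJ
  have hJc : (Finset.univ.filter fun j => ε j = ε' j) = Jᶜ := by ext j; simp [hJ]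
  have hτ0 : 0 ≤ p * (1 - p) := mul_nonneg h0 (by linarith)
  have hτ1 : p * (1 - p) ≤ 1 / 4 := by nlinarith [sq_nonneg (p - 1 / 2)]
  rw [hJc]
  calc _ ≤ _ := Finset.sum_le_sum fun r _ => mul_le_mul_of_nonneg_left
        (b := if NearZero ε r ∧ NearZero ε' r then (1 : ℝ) else 0)
        (c := if ∑ j ∈ J, (ε j : ℤ) * pairDiff r j = 0 ∧ (∑ j ∈ Jᶜ, (ε j : ℤ) * pairDiff r j = 0 ∨
        ∑ j ∈ Jᶜ, (ε j : ℤ) * pairDiff r j = -1) then 1 else 0) ?_ (rowWeight_nonneg h0 h1 r)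
    _ = _ := sum_rowWeight_split_zero_or p ε J
    _ ≤ _ := by
      have ha := neighborProb_le_returnProb hτ0 hτ1 Jᶜ.card
      have hb := returnProb_nonneg hτ0 hτ1 J.card
      nlinarith
  have e1 : ∑ j, (ε j : ℤ) * pairDiff r j = ∑ j ∈ J, (ε j : ℤ) * pairDiff r j
      + ∑ j ∈ Jᶜ, (ε j : ℤ) * pairDiff r j := (Finset.sum_add_sum_compl J _).symm
  have e2 : ∑ j, (ε' j : ℤ) * pairDiff r j = -∑ j ∈ J, (ε j : ℤ) * pairDiff r j
      + ∑ j ∈ Jᶜ, (ε j : ℤ) * pairDiff r j := by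
    rw [← Finset.sum_add_sum_compl J, ← Finset.sum_neg_distrib]
    congr 1
    · refine Finset.sum_congr rfl fun j hj => ?_
      have hne : ε j ≠ ε' j := by simpa [hJ] using hj
      rcases Int.units_eq_one_or (ε j) with h | h <;>
        rcases Int.units_eq_one_or (ε' j) with h' | h' <;> simp_all
    · refine Finset.sum_congr rfl fun j hj => ?_
      have he : ε j = ε' j := by simpa [hJ] using hj
      rw [he]
  have himp : NearZero ε r ∧ NearZero ε' r →
      ∑ j ∈ J, (ε j : ℤ) * pairDiff r j = 0 ∧ (∑ j ∈ Jᶜ, (ε j : ℤ) * pairDiff r j = 0 ∨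
        ∑ j ∈ Jᶜ, (ε j : ℤ) * pairDiff r j = -1) := by
    unfold NearZero
    rw [e1, e2]
    omega
  split_ifs with ha hb hb
  · exact le_rfl
  · exact absurd (himp ha) hb
  · exact zero_le_one
  · exact le_rfl

/-! ### Discrepancy of bit matrices -/

/-- The real matrix with the given bits. -/
def bitMatrix {m n : ℕ} (M : Fin m → Fin n → Bool) : Matrix (Fin m) (Fin n) ℝ :=
  fun i j => ((M i j).toNat : ℝ)

/-- The row has an even number of ones. -/
def EvenRow {n : ℕ} (r : Fin n → Bool) : Prop := Even (∑ j, (r j).toNat)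

lemma bitMatrix_mulVec_signVec {m n : ℕ} (M : Fin m → Fin n → Bool) (u : Fin n → ℤˣ) (i : Fin m) :
    (bitMatrix M).mulVec (signVec u) i = ((∑ j, ((M i j).toNat : ℤ) * (u j : ℤ) : ℤ) : ℝ) := by
  simp [Matrix.mulVec, dotProduct, bitMatrix, signVec]

/-- Signs are `1` modulo `2`, so an odd row always has an odd, hence nonzero, signed sum. -/
lemma one_le_disc_bitMatrix {m n : ℕ} {M : Fin m → Fin n → Bool} (h : ∃ i, ¬ EvenRow (M i)) :
    1 ≤ disc (bitMatrix M) := by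
  obtain ⟨i, hi⟩ := h
  refine Finset.le_inf' _ _ fun u _ => le_trans ?_ (norm_le_pi_norm _ i)
  rw [bitMatrix_mulVec_signVec]
  have hne : ∑ j, ((M i j).toNat : ℤ) * (u j : ℤ) ≠ 0 := by
    intro h0
    apply hi
    have hz : ((∑ j, (M i j).toNat : ℕ) : ZMod 2) = 0 := by
      have := congrArg (Int.cast : ℤ → ZMod 2) h0
      push_cast at this ⊢
      rw [← this]
      refine Finset.sum_congr rfl fun j _ => ?_
      rcases Int.units_eq_one_or (u j) with h | h <;> rw [h] <;> cases M i j <;> decide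
    exact (ZMod.natCast_eq_zero_iff_even).mp hz
  rw [Real.norm_eq_abs]
  exact_mod_cast Int.one_le_abs hne

/-- Here `c` is the contribution of the unpaired columns, of which there is at most one. -/
lemma sum_mul_pairVec {n : ℕ} (ε : Fin (n / 2) → ℤˣ) (r : Fin n → Bool) :
    ∃ c : ℤ, 0 ≤ c ∧ c ≤ 1 ∧ ∑ i, ((r i).toNat : ℤ) * ((pairVec ε 1 i : ℤˣ) : ℤ)
      = ∑ j, (ε j : ℤ) * pairDiff r j + c := by
  classical
  set T : Finset (Fin n) := Finset.univ.image pairIdx with hT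
  have hcard : T.card = 2 * (n / 2) := by
    rw [hT, Finset.card_image_of_injective _ pairIdx_injective]
    simp [mul_comm]
  refine ⟨∑ i ∈ Tᶜ, ((r i).toNat : ℤ), Finset.sum_nonneg fun _ _ => by positivity, ?_, ?_⟩
  · calc ∑ i ∈ Tᶜ, ((r i).toNat : ℤ) ≤ ∑ i ∈ Tᶜ, 1 :=
          Finset.sum_le_sum fun i _ => by exact_mod_cast Bool.toNat_le (r i)
      _ ≤ 1 := by
          rw [Finset.sum_const, Finset.card_compl, hcard, Fintype.card_fin]
          simp; omega
  · rw [← Finset.sum_add_sum_compl T]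
    congr 1
    · rw [hT, Finset.sum_image (fun _ _ _ _ h => pairIdx_injective h), Fintype.sum_prod_type]
      refine Finset.sum_congr rfl fun j _ => ?_
      simp [pairVec_pairIdx, pairDiff]
      ring
    · refine Finset.sum_congr rfl fun i hi => ?_
      rw [pairVec_of_notMem ε 1 (by simpa [hT] using hi)]
      simp

lemma disc_bitMatrix_le_one {m n : ℕ} {M : Fin m → Fin n → Bool} {ε : Fin (n / 2) → ℤˣ}
    (h : ∀ i, NearZero ε (M i)) : disc (bitMatrix M) ≤ 1 := by
  refine (Finset.inf'_le _ (Finset.mem_univ (pairVec ε 1))).trans ?_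
  refine (pi_norm_le_iff_of_nonneg zero_le_one).mpr fun i => ?_
  rw [bitMatrix_mulVec_signVec, Real.norm_eq_abs]
  obtain ⟨c, h0, h1, hc⟩ := sum_mul_pairVec ε (M i)
  rw [hc]
  have : |∑ j, (ε j : ℤ) * pairDiff (M i) j + c| ≤ 1 := by
    rcases h i with h | h <;> rw [h, abs_le] <;> omega
  exact_mod_cast this

/-- The weight of the rows with an even number of ones. -/
theorem sum_rowWeight_evenRow {n : ℕ} (p : ℝ) [DecidablePred (EvenRow (n := n))] :
    ∑ r : Fin n → Bool, rowWeight p r * (if EvenRow r then 1 else 0)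
      = (1 + (1 - 2 * p) ^ n) / 2 := by
  -- The indicator of evenness is `(1 + (-1)^N)/2`, with `N` the number of ones.
  have h1 : ∀ r : Fin n → Bool, rowWeight p r * (if EvenRow r then (1 : ℝ) else 0)
      = (rowWeight p r + ∏ i, (bernWeight p (r i) * (-1) ^ (r i).toNat)) / 2 := by
    intro r
    rw [Finset.prod_mul_distrib, Finset.prod_pow_eq_pow_sum, ← rowWeight]
    split_ifs with h
    · rw [Even.neg_one_pow h]; ring
    · rw [Odd.neg_one_pow (Nat.not_even_iff_odd.mp h)]; ring
  simp_rw [h1]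
  rw [← Finset.sum_div, Finset.sum_add_distrib, sum_rowWeight,
    sum_prod_apply (fun (_ : Fin n) b => bernWeight p b * (-1) ^ b.toNat)]
  simp [bernWeight]
  ring

/-! ### From random matrices to weights -/

-- The events that `A` equals a given bit matrix are disjoint, null-measurable and of product
-- weight. Only an inequality is claimed, so neither measurability of the target event nor control
-- of non-bit values of `A` is required.
open Classical in
theorem sum_weight_le_measure {Ω : Type*} [MeasurableSpace Ω] {P : Measure Ω}
    {m n : ℕ} {p : I} {A : Ω → Matrix (Fin m) (Fin n) ℝ} (hA : IsBernoulliEnsemble P p A)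
    (G : Matrix (Fin m) (Fin n) ℝ → Prop) :
    ENNReal.ofReal (∑ M : Fin m → Fin n → Bool, (∏ i, rowWeight (p : ℝ) (M i)) *
      if G (bitMatrix M) then 1 else 0) ≤ P {ω | G (A ω)} := by
  have hp0 := p.2.1
  have hp1 := p.2.2
  set V : (Fin m → Fin n → Bool) → Set Ω := fun M =>
    ⋂ x ∈ (Finset.univ : Finset (Fin m × Fin n)),
      (fun ω => A ω x.1 x.2) ⁻¹' {((M x.1 x.2).toNat : ℝ)} with hV
  have hmem : ∀ M ω, ω ∈ V M ↔ A ω = bitMatrix M := by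
    intro M ω
    simp only [hV, Finset.mem_univ, Set.iInter_true, Set.mem_iInter, Set.mem_preimage,
      Set.mem_singleton_iff, Prod.forall]
    exact ⟨fun h => by ext i j; exact h i j, fun h i j => by rw [h]; rfl⟩
  have hnull : ∀ M, NullMeasurableSet (V M) P := fun M =>
    Finset.nullMeasurableSet_biInter _ fun x _ =>
      (hA.hasLaw_entry x.1 x.2).aemeasurable.nullMeasurableSet_preimage (measurableSet_singleton _)
  have hmeas : ∀ M, P (V M) = ENNReal.ofReal (∏ i, rowWeight (p : ℝ) (M i)) := by
    intro M
    rw [hV]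
    simp only
    rw [hA.indep.measure_inter_preimage_eq_mul Finset.univ
      (sets := fun x => {((M x.1 x.2).toNat : ℝ)}) (fun _ _ => measurableSet_singleton _),
      Fintype.prod_prod_type, ENNReal.ofReal_prod_of_nonneg fun i _ => rowWeight_nonneg hp0 hp1 _]
    refine Finset.prod_congr rfl fun i _ => ?_
    rw [rowWeight, ENNReal.ofReal_prod_of_nonneg fun j _ => bernWeight_nonneg hp0 hp1 _]
    refine Finset.prod_congr rfl fun j _ => ?_
    have h := hA.hasLaw_entry i j
    rw [← Measure.map_apply_of_aemeasurable h.aemeasurable (measurableSet_singleton _), h.map_eq,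
      ← ofReal_measureReal]
    congr 1
    cases M i j
    · rw [bernoulliMeasure_real_apply_of_notMem_of_mem _ (measurableSet_singleton _) (by simp)
        (by simp)]
      simp [bernWeight]
    · rw [bernoulliMeasure_real_apply_of_mem_of_notMem _ (measurableSet_singleton _) (by simp)
        (by simp)]
      simp [bernWeight]
  have hinj : ∀ M N : Fin m → Fin n → Bool, bitMatrix M = bitMatrix N → M = N := by
    intro M N h
    ext i j
    have := congrFun (congrFun h i) j
    simp only [bitMatrix] at this
    revert this
    cases M i j <;> cases N i j <;> simp
  set T := Finset.univ.filter fun M : Fin m → Fin n → Bool => G (bitMatrix M) with hT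
  have hsub : (⋃ M ∈ T, V M) ⊆ {ω | G (A ω)} := by
    intro ω hω
    simp only [Set.mem_iUnion] at hω
    obtain ⟨M, hM, hω⟩ := hω
    rw [Set.mem_ofPred_eq, (hmem M ω).mp hω]
    simpa [hT] using hM
  refine le_trans (le_of_eq ?_) (measure_mono hsub)
  rw [measure_biUnion_finset₀ (fun M _ N _ hMN => Disjoint.aedisjoint ?_) (fun M _ => hnull M)]
  · simp_rw [hmeas]
    rw [← ENNReal.ofReal_sum_of_nonneg fun M _ =>
      Finset.prod_nonneg fun i _ => rowWeight_nonneg hp0 hp1 _, hT, Finset.sum_filter]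
    simp
  · refine Set.disjoint_left.mpr fun ω h1 h2 => hMN (hinj M N ?_)
    rw [← (hmem M ω).mp h1, (hmem N ω).mp h2]

/-! ### The second moment bound -/

/-- For fixed `ε`, multiplication by `ε` permutes the sign vectors. -/
lemma sum_sum_sign {k : ℕ} (F : ℝ → ℝ) :
    ∑ ε : Fin k → ℤˣ, ∑ ε' : Fin k → ℤˣ, F (∑ j, (((ε j * ε' j : ℤˣ) : ℤ) : ℝ))
      = 2 ^ k * ∑ δ : Fin k → ℤˣ, F (∑ j, ((δ j : ℤ) : ℝ)) := by
  have : ∀ ε : Fin k → ℤˣ, ∑ ε' : Fin k → ℤˣ, F (∑ j, (((ε j * ε' j : ℤˣ) : ℤ) : ℝ))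
      = ∑ δ : Fin k → ℤˣ, F (∑ j, ((δ j : ℤ) : ℝ)) := fun ε =>
    Equiv.sum_comp (Equiv.mulLeft ε) fun δ : Fin k → ℤˣ => F (∑ j, ((δ j : ℤ) : ℝ))
  simp_rw [this]
  simp

lemma sum_sign_mul {k : ℕ} (ε ε' : Fin k → ℤˣ) :
    ∑ j, (((ε j * ε' j : ℤˣ) : ℤ) : ℝ) = ((Finset.univ.filter fun j => ε j = ε' j).card : ℝ)
      - (Finset.univ.filter fun j => ε j ≠ ε' j).card := by
  rw [Finset.card_filter, Finset.card_filter]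
  push_cast
  rw [← Finset.sum_sub_distrib]
  refine Finset.sum_congr rfl fun j _ => ?_
  rcases Int.units_eq_one_or (ε j) with h | h <;>
    rcases Int.units_eq_one_or (ε' j) with h' | h' <;> simp [h, h']

theorem sum_sum_nearZero_le {m n : ℕ} {p : ℝ} (h0 : 0 < p) (h1 : p ≤ 1 / 2)
    (hs : 24 ≤ p * (1 - p) * (n / 2 : ℕ)) (hm : 2 * (m : ℝ) < (n / 2 : ℕ)) {q : ℝ}
    (hq : q = returnProb (p * (1 - p)) (n / 2) + neighborProb (p * (1 - p)) (n / 2)) :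
    ∑ ε : Fin (n / 2) → ℤˣ, ∑ ε' : Fin (n / 2) → ℤˣ, (∑ r : Fin n → Bool,
        rowWeight p r * if NearZero ε r ∧ NearZero ε' r then 1 else 0) ^ m
      ≤ ((2 : ℝ) ^ (n / 2) * q ^ m) ^ 2
        * (Real.exp (1488 * m / (p * (1 - p) * (n / 2 : ℕ))) / √(1 - 2 * m / (n / 2 : ℕ))
          + 2 * Real.exp (-(n / 2 : ℕ) / 16) * (2 * √(n / 2 : ℕ)) ^ m) := by
  set k := n / 2 with hk
  set τ := p * (1 - p) with hτ
  have hτ0 : 0 < τ := mul_pos h0 (by linarith)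
  have hτ1 : τ ≤ 1 / 4 := by nlinarith [sq_nonneg (p - 1 / 2)]
  have hk0 : 0 < k := by
    rcases Nat.eq_zero_or_pos k with h | h
    · rw [h] at hs; norm_num at hs
    · exact h
  have hk0' : (0 : ℝ) < k := by exact_mod_cast hk0
  set s := τ * k with hsdef
  have hs0 : 0 < s := by positivity
  have hp1 : p ≤ 1 := by linarith
  -- `q ≥ (1/2)/√(πτk)` and `πτ ≤ 1`.
  have hqlow : 1 ≤ q * (2 * √k) := by
    have h := returnProb_add_neighborProb_ge hτ0 hτ1 hk0
    rw [← hq, ← hsdef] at h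
    have hx : 12 / s ≤ 1 / 2 := by rw [div_le_div_iff₀ hs0 (by norm_num)]; linarith
    have h2 : √(Real.pi * s) ≤ √k := by
      apply Real.sqrt_le_sqrt
      rw [hsdef]
      nlinarith [Real.pi_le_four, Real.pi_pos, mul_nonneg hτ0.le hk0'.le]
    have h3 : 0 < √(Real.pi * s) := by positivity
    rw [div_le_iff₀ h3] at h
    have hq0 : 0 < q := by
      by_contra hn
      nlinarith
    nlinarith
  have hq0 : 0 < q := by
    by_contra hn
    have : 0 < √(k : ℝ) := by positivity
    nlinarith
  have hpt : ∀ ε ε' : Fin k → ℤˣ, (∑ r : Fin n → Bool,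
      rowWeight p r * if NearZero ε r ∧ NearZero ε' r then (1 : ℝ) else 0) ^ m
      ≤ (q ^ m) ^ 2 * (Real.exp (1488 * m / s)
        * Real.exp (m / k ^ 2 * (∑ j, (((ε j * ε' j : ℤˣ) : ℤ) : ℝ)) ^ 2)
        + Real.exp (-k / 16) * (2 * √k) ^ m
          * Real.exp (1 / (4 * k) * (∑ j, (((ε j * ε' j : ℤˣ) : ℤ) : ℝ)) ^ 2)) := by
    intro ε ε'
    rw [sum_sign_mul]
    set a := (Finset.univ.filter fun j => ε j = ε' j).card with ha
    set b := (Finset.univ.filter fun j => ε j ≠ ε' j).card with hb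
    have hab : a + b = k := by
      rw [ha, hb, Finset.card_filter_add_card_filter_not, Finset.card_univ, Fintype.card_fin]
    have hab' : (a : ℝ) + b = k := by exact_mod_cast hab
    have hQ0 : 0 ≤ ∑ r : Fin n → Bool,
        rowWeight p r * if NearZero ε r ∧ NearZero ε' r then (1 : ℝ) else 0 :=
      Finset.sum_nonneg fun r _ => mul_nonneg (rowWeight_nonneg h0.le hp1 r)
        (by split_ifs <;> norm_num)
    by_cases hbal : k ≤ 4 * a ∧ k ≤ 4 * b
    · calc _ ≤ (q ^ 2 * Real.exp ((((a : ℝ) - b) / k) ^ 2 + 1488 / s)) ^ m := by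
            refine pow_le_pow_left₀ hQ0 ?_ m
            rw [hq]
            exact (sum_rowWeight_nearZero_and_le h0.le hp1 ε ε').trans
              (two_mul_returnProb_mul_returnProb_le hτ0 hτ1 hab hbal.1 hbal.2 hs)
        _ = (q ^ m) ^ 2 * (Real.exp (1488 * m / s)
              * Real.exp (m / k ^ 2 * ((a : ℝ) - b) ^ 2)) := by
            rw [mul_pow, ← Real.exp_nat_mul, ← Real.exp_add, ← pow_mul, ← pow_mul, mul_comm 2 m]
            congr 2
            rw [div_pow]; ring
        _ ≤ _ := by
            gcongr
            exact le_add_of_nonneg_right (by positivity)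
    · have hQq : ∑ r : Fin n → Bool,
          rowWeight p r * (if NearZero ε r ∧ NearZero ε' r then (1 : ℝ) else 0) ≤ q := by
        rw [hq, ← sum_rowWeight_nearZero p ε]
        refine Finset.sum_le_sum fun r _ =>
          mul_le_mul_of_nonneg_left ?_ (rowWeight_nonneg h0.le hp1 r)
        by_cases h : NearZero ε r <;> by_cases h' : NearZero ε' r <;> simp [h, h']
      have hfar : (k : ℝ) ^ 2 / 4 ≤ ((a : ℝ) - b) ^ 2 := by
        rcases not_and_or.mp hbal with h | h
        · have : (4 * a : ℝ) < k := by exact_mod_cast not_le.mp h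
          nlinarith
        · have : (4 * b : ℝ) < k := by exact_mod_cast not_le.mp h
          nlinarith
      -- One row probability is bounded by `q`; the missing `q^m` is bought with `q · 2√k ≥ 1`. The
      -- exponential is at least `1` on unbalanced pairs and makes their sum small, as in Markov's
      -- inequality.
      calc _ ≤ q ^ m := pow_le_pow_left₀ hQ0 hQq m
        _ = (q ^ m) * 1 ^ m * 1 := by simp
        _ ≤ (q ^ m) * (q * (2 * √k)) ^ m
            * Real.exp (-k / 16 + 1 / (4 * k) * ((a : ℝ) - b) ^ 2) := by
            gcongr
            apply Real.one_le_exp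
            have : 1 / (4 * k) * ((k : ℝ) ^ 2 / 4) ≤ 1 / (4 * k) * ((a : ℝ) - b) ^ 2 := by gcongr
            have e : 1 / (4 * k) * ((k : ℝ) ^ 2 / 4) = k / 16 := by field_simp; norm_num
            linarith
        _ = (q ^ m) ^ 2 * (Real.exp (-k / 16) * (2 * √k) ^ m
            * Real.exp (1 / (4 * k) * ((a : ℝ) - b) ^ 2)) := by
            rw [Real.exp_add, mul_pow]; ring
        _ ≤ _ := by
            gcongr
            exact le_add_of_nonneg_left (by positivity)
  have hB1 := sum_exp_sq_sum_sign_le (k := k) (c := m / k ^ 2) (by positivity) (by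
    have : 2 * ((m : ℝ) / k ^ 2) * k = 2 * m / k := by field_simp
    rw [this, div_lt_one hk0']; exact hm)
  -- This `c` makes `2ck = 1/2`, so the moment is within a constant of `2^k`.
  have hB2 := sum_exp_sq_sum_sign_le (k := k) (c := 1 / (4 * k)) (by positivity) (by
    have : 2 * (1 / (4 * (k : ℝ))) * k = 1 / 2 := by field_simp; norm_num
    rw [this]; norm_num)
  have e1 : 2 * ((m : ℝ) / k ^ 2) * k = 2 * m / k := by field_simp
  have e2 : 2 * (1 / (4 * (k : ℝ))) * k = 1 / 2 := by field_simp; norm_num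
  rw [e1] at hB1
  rw [e2] at hB2
  have hB2' : ∑ δ : Fin k → ℤˣ, Real.exp (1 / (4 * k) * (∑ j, ((δ j : ℤ) : ℝ)) ^ 2)
      ≤ 2 ^ k * 2 := by
    refine hB2.trans ?_
    have : 1 / 2 ≤ √(1 - 1 / 2) := by
      apply Real.le_sqrt_of_sq_le; norm_num
    rw [div_le_iff₀ (by linarith)]
    nlinarith [pow_pos (two_pos : (0 : ℝ) < 2) k]
  calc _ ≤ _ := Finset.sum_le_sum fun ε _ => Finset.sum_le_sum fun ε' _ => hpt ε ε'
    _ = (q ^ m) ^ 2 * (Real.exp (1488 * m / s)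
        * (2 ^ k * ∑ δ : Fin k → ℤˣ, Real.exp (m / k ^ 2 * (∑ j, ((δ j : ℤ) : ℝ)) ^ 2))
        + Real.exp (-k / 16) * (2 * √k) ^ m
          * (2 ^ k * ∑ δ : Fin k → ℤˣ, Real.exp (1 / (4 * k) * (∑ j, ((δ j : ℤ) : ℝ)) ^ 2))) := by
        rw [← sum_sum_sign (fun x => Real.exp (m / k ^ 2 * x ^ 2)),
          ← sum_sum_sign (fun x => Real.exp (1 / (4 * k) * x ^ 2))]
        simp only [← Finset.mul_sum, Finset.sum_add_distrib]
    _ ≤ (q ^ m) ^ 2 * (Real.exp (1488 * m / s) * (2 ^ k * (2 ^ k / √(1 - 2 * m / k)))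
        + Real.exp (-k / 16) * (2 * √k) ^ m * (2 ^ k * (2 ^ k * 2))) := by gcongr
    _ = _ := by ring

/-- A quantitative lower bound for the probability that the discrepancy is `1`. -/
theorem measure_disc_eq_one_ge {Ω : Type*} [MeasurableSpace Ω] {P : Measure Ω}
    {m n : ℕ} {p : I} {A : Ω → Matrix (Fin m) (Fin n) ℝ} (hA : IsBernoulliEnsemble P p A)
    (h0 : 0 < (p : ℝ)) (h1 : (p : ℝ) ≤ 1 / 2)
    (hs : 24 ≤ (p : ℝ) * (1 - p) * (n / 2 : ℕ)) (hm : 2 * (m : ℝ) < (n / 2 : ℕ)) {K : ℝ}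
    (hK : Real.exp (1488 * m / (p * (1 - p) * (n / 2 : ℕ))) / √(1 - 2 * m / (n / 2 : ℕ))
          + 2 * Real.exp (-(n / 2 : ℕ) / 16) * (2 * √(n / 2 : ℕ)) ^ m ≤ K) :
    ENNReal.ofReal (1 / K - ((1 + (1 - 2 * p) ^ n) / 2) ^ m) ≤ P {ω | disc (A ω) = 1} := by
  classical
  have hp1 : (p : ℝ) ≤ 1 := p.2.2
  refine le_trans (ENNReal.ofReal_le_ofReal ?_)
    (sum_weight_le_measure hA fun B => disc B = 1)
  set W : (Fin m → Fin n → Bool) → ℝ := fun M => ∏ i, rowWeight (p : ℝ) (M i) with hW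
  have hW0 : ∀ M, 0 ≤ W M := fun M => Finset.prod_nonneg fun i _ => rowWeight_nonneg h0.le hp1 _
  -- A good signing forces discrepancy `1` unless every row is even.
  have hsplit : (∑ M, W M * if ∃ ε : Fin (n / 2) → ℤˣ, ∀ i, NearZero ε (M i) then 1 else 0)
      ≤ (∑ M, W M * if disc (bitMatrix M) = 1 then 1 else 0)
        + ∑ M, W M * ∏ i, (if EvenRow (M i) then 1 else 0) := by
    rw [← Finset.sum_add_distrib]
    refine Finset.sum_le_sum fun M _ => ?_
    rw [← mul_add]
    refine mul_le_mul_of_nonneg_left ?_ (hW0 M)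
    have hnn : (0 : ℝ) ≤ ∏ i, (if EvenRow (M i) then 1 else 0) :=
      Finset.prod_nonneg fun i _ => by split_ifs <;> norm_num
    by_cases hex : ∃ ε : Fin (n / 2) → ℤˣ, ∀ i, NearZero ε (M i)
    · by_cases hev : ∃ i, ¬ EvenRow (M i)
      · have hd : disc (bitMatrix M) = 1 :=
          le_antisymm (disc_bitMatrix_le_one hex.choose_spec) (one_le_disc_bitMatrix hev)
        rw [if_pos hex, if_pos hd]
        linarith
      · push Not at hev
        rw [if_pos hex, Finset.prod_eq_one fun i _ => if_pos (hev i)]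
        split_ifs <;> norm_num
    · rw [if_neg hex]
      split_ifs <;> linarith
  have hE : ∑ M, W M * ∏ i, (if EvenRow (M i) then (1 : ℝ) else 0)
      = ((1 + (1 - 2 * (p : ℝ)) ^ n) / 2) ^ m := by
    rw [← sum_rowWeight_evenRow]
    exact sum_prod_mul_prod (rowWeight (p : ℝ)) fun r => if EvenRow r then (1 : ℝ) else 0
  rw [hE] at hsplit
  set q := returnProb ((p : ℝ) * (1 - p)) (n / 2) + neighborProb ((p : ℝ) * (1 - p)) (n / 2)
    with hq
  have h2 := second_moment (m := m) (rowWeight (ι := Fin n) (p : ℝ))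
    (rowWeight_nonneg h0.le hp1) (NearZero (n := n))
  have h3 := sum_sum_nearZero_le (m := m) h0 h1 hs hm hq
  have hk0 : 0 < n / 2 := by
    rcases Nat.eq_zero_or_pos (n / 2) with h | h
    · rw [h] at hs; norm_num at hs
    · exact h
  have hk0' : (0 : ℝ) < (n / 2 : ℕ) := by exact_mod_cast hk0
  have hτ0 : 0 < (p : ℝ) * (1 - p) := mul_pos h0 (by linarith)
  have hq0 : 0 < q := by
    refine lt_of_lt_of_le ?_ (returnProb_add_neighborProb_ge hτ0
      (by nlinarith [sq_nonneg ((p : ℝ) - 1 / 2)]) hk0)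
    have : 12 / ((p : ℝ) * (1 - p) * (n / 2 : ℕ)) ≤ 1 / 2 := by
      rw [div_le_div_iff₀ (by positivity) (by norm_num)]; linarith
    have : 0 < 1 - 12 / ((p : ℝ) * (1 - p) * (n / 2 : ℕ)) := by linarith
    positivity
  have hx : 0 < 1 - 2 * (m : ℝ) / (n / 2 : ℕ) := by
    rw [sub_pos, div_lt_one hk0']; exact hm
  have hK0 : 0 < K := lt_of_lt_of_le (by positivity) hK
  have h4 : ∑ ε : Fin (n / 2) → ℤˣ, (∑ r : Fin n → Bool, rowWeight (p : ℝ) r *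
      if NearZero ε r then (1 : ℝ) else 0) ^ m = 2 ^ (n / 2) * q ^ m := by
    simp_rw [sum_rowWeight_nearZero, ← hq]
    simp
  set X := ∑ M, W M * if ∃ ε : Fin (n / 2) → ℤˣ, ∀ i, NearZero ε (M i) then (1 : ℝ) else 0
    with hX
  have hX0 : 0 ≤ X := Finset.sum_nonneg fun M _ => mul_nonneg (hW0 M)
    (by split_ifs <;> norm_num)
  have h5 : ((2 : ℝ) ^ (n / 2) * q ^ m) ^ 2 ≤ X * (((2 : ℝ) ^ (n / 2) * q ^ m) ^ 2 * K) := by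
    rw [← h4]
    refine (le_of_eq ?_).trans (h2.trans ((mul_le_mul_of_nonneg_left (h3.trans ?_) hX0).trans' ?_))
    -- The two sides differ only in decidability instances.
    · congr!
    · rw [h4]; gcongr
    · apply le_of_eq
      rw [hX]
      congr!
  have h6 : 1 / K ≤ X := by
    rw [div_le_iff₀ hK0]
    have hpos : 0 < ((2 : ℝ) ^ (n / 2) * q ^ m) ^ 2 := by positivity
    nlinarith
  linarith

/-! ### Asymptotics and conclusion -/

/-- The far pairs of sign vectors contribute an exponentially small amount. -/
lemma exp_mul_two_sqrt_pow_le {m k : ℕ} (hm : 0 < m) (hk : 4096 * (m : ℝ) ≤ k)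
    (hlog : 32 * (m * Real.log m) ≤ (k : ℝ)) :
    2 * Real.exp (-k / 16) * (2 * √k) ^ m ≤ 2 * Real.exp (-m) := by
  have hm' : (0 : ℝ) < m := by exact_mod_cast hm
  have hk' : (0 : ℝ) < k := by linarith
  have h1 : 2 * √(k : ℝ) = Real.exp (Real.log 2 + Real.log k / 2) := by
    rw [Real.exp_add, Real.exp_log two_pos, ← Real.log_sqrt hk'.le,
      Real.exp_log (Real.sqrt_pos.mpr hk')]
  rw [h1, ← Real.exp_nat_mul, mul_assoc, ← Real.exp_add]
  gcongr
  -- `log k = 2 log y + log m`, and `y ≥ 64` gives `m log y ≤ m y ≤ m y²/64 = k/64`; hence the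
  -- requirement `k ≥ 64² m`.
  set y := √((k : ℝ) / m) with hy
  have hy0 : 0 < y := by positivity
  have hy2 : y ^ 2 * m = k := by rw [hy, Real.sq_sqrt (by positivity)]; field_simp
  have hy64 : 64 ≤ y := by
    apply Real.le_sqrt_of_sq_le
    rw [le_div_iff₀ hm']; linarith
  have hlogk : Real.log k = 2 * Real.log y + Real.log m := by
    rw [← hy2, Real.log_mul (by positivity) (by positivity), Real.log_pow]; push_cast; ring
  have hly : Real.log y ≤ y := (Real.log_le_sub_one_of_pos hy0).trans (by linarith)
  have h2 : m * Real.log y ≤ k / 64 := by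
    calc m * Real.log y ≤ m * y := by gcongr
      _ ≤ k / 64 := by rw [← hy2]; nlinarith [mul_pos hm' hy0]
  have h3 : m * Real.log 2 ≤ (m : ℝ) := by nlinarith [Real.log_two_lt_d9]
  rw [hlogk]
  linarith

theorem mainTheorem9 :
    ∃ C : ℝ, 0 < C ∧
      ∀ (n : ℕ → ℕ) (p : ℕ → I),
        (∀ m, (p m : ℝ) ≤ 1 / 2) →
        (∀ᶠ m : ℕ in atTop, C * (m : ℝ) * Real.log (m : ℝ) ≤ (n m : ℝ)) →
        (fun m : ℕ => (m : ℝ)) =o[atTop] (fun m : ℕ => (n m : ℝ) * (p m : ℝ)) →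
        ∀ (Ω : ℕ → Type*) [∀ m, MeasurableSpace (Ω m)]
          (P : ∀ m, Measure (Ω m)) [∀ m, IsProbabilityMeasure (P m)]
          (A : ∀ m, Ω m → Matrix (Fin m) (Fin (n m)) ℝ),
          (∀ m, IsBernoulliEnsemble (P m) (p m) (A m)) →
          Tendsto (fun m => P m {ω | disc (A m ω) = 1}) atTop (𝓝 1) := by
  -- `96 = 3 · 32`: the far pairs need `k ≥ 32 m log m`, and `k ≥ n/3`.
  refine ⟨96, by norm_num, fun n p hp hn ho Ω _ P _ A hA => ?_⟩
  set x : ℕ → ℝ := fun m => m / (n m * p m) with hx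
  have hxlim : Tendsto x atTop (𝓝 0) := ho.tendsto_div_nhds_zero
  -- `8928 = 6 · 1488` because `τk ≥ np/6`, and `2m/k ≤ 3x` because `p ≤ 1/2`.
  set U : ℕ → ℝ := fun m => Real.exp (8928 * x m) / √(1 - 3 * x m) + 2 * Real.exp (-(m : ℝ)) with hU
  have hUlim : Tendsto U atTop (𝓝 1) := by
    have h1 : Tendsto (fun m => Real.exp (8928 * x m)) atTop (𝓝 1) := by
      have := (hxlim.const_mul 8928).rexp
      simpa using this
    have h2 : Tendsto (fun m => √(1 - 3 * x m)) atTop (𝓝 1) := by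
      have := ((hxlim.const_mul 3).const_sub 1).sqrt
      simpa using this
    have h3 : Tendsto (fun m : ℕ => Real.exp (-(m : ℝ))) atTop (𝓝 0) :=
      Real.tendsto_exp_neg_atTop_nhds_zero.comp tendsto_natCast_atTop_atTop
    have := (h1.div h2 one_ne_zero).add (h3.const_mul 2)
    simpa using this
  have hlow : Tendsto (fun m => ENNReal.ofReal (1 / U m - (3 / 4) ^ m)) atTop (𝓝 1) := by
    have h1 : Tendsto (fun m : ℕ => (3 / 4 : ℝ) ^ m) atTop (𝓝 0) :=
      tendsto_pow_atTop_nhds_zero_of_lt_one (by norm_num) (by norm_num)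
    have := ENNReal.tendsto_ofReal (((tendsto_const_nhds (x := (1 : ℝ))).div hUlim one_ne_zero).sub h1)
    simpa using this
  refine tendsto_of_tendsto_of_tendsto_of_le_of_le' hlow tendsto_const_nhds ?_
    (Eventually.of_forall fun m => prob_le_one)
  have hsmall : ∀ᶠ m in atTop, x m ≤ 1 / 12288 :=
    hxlim.eventually_le_const (by norm_num)
  -- With `np ≥ m ≥ 144`, the bound `τk ≥ np/6` gives the required `τk ≥ 24`.
  filter_upwards [hn, hsmall, ho.bound one_pos, eventually_ge_atTop 144] with m hnm hxm hb hm144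
  have hm' : (144 : ℝ) ≤ m := by exact_mod_cast hm144
  have hp0 : 0 ≤ (p m : ℝ) := (p m).2.1
  have hph := hp m
  have hnp0 : 0 ≤ (n m : ℝ) * p m := by positivity
  rw [Real.norm_of_nonneg (by positivity), Real.norm_of_nonneg hnp0, one_mul] at hb
  have hnp : 0 < (n m : ℝ) * p m := by linarith
  have hppos : 0 < (p m : ℝ) := by
    rcases hp0.eq_or_lt with h | h
    · rw [← h, mul_zero] at hnp; exact absurd hnp (lt_irrefl _)
    · exact h
  have hmx : 12288 * (m : ℝ) ≤ n m * p m := by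
    rw [hx] at hxm
    simp only at hxm
    rw [div_le_div_iff₀ hnp (by norm_num)] at hxm
    linarith
  have hnbig : 24576 * (m : ℝ) ≤ n m := by nlinarith [(Nat.cast_nonneg (n m) : (0 : ℝ) ≤ n m)]
  have hk3 : (n m : ℝ) ≤ 3 * (n m / 2 : ℕ) := by
    have h2 : 2 ≤ n m := by
      have : (2 : ℝ) ≤ n m := by linarith
      exact_mod_cast this
    have : n m ≤ 3 * (n m / 2) := by omega
    exact_mod_cast this
  set k := n m / 2 with hk
  have hk4096 : 4096 * (m : ℝ) ≤ k := by linarith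
  have hk0 : (0 : ℝ) < k := by linarith
  have hs : (n m : ℝ) * p m / 6 ≤ p m * (1 - p m) * k := by
    have h1 : (n m : ℝ) * p m * (1 / 2) ≤ 3 * k * p m * (1 - p m) := by
      gcongr
      linarith
    linarith
  have hs0 : 0 < (p m : ℝ) * (1 - p m) * k := by linarith
  have hmk : 2 * (m : ℝ) / k ≤ 3 * x m := by
    rw [hx]
    simp only
    rw [mul_div_assoc', div_le_div_iff₀ hk0 hnp]
    have : (n m : ℝ) * p m ≤ 3 * k * (1 / 2) := by gcongr
    nlinarith
  have hms : 1488 * (m : ℝ) / (p m * (1 - p m) * k) ≤ 8928 * x m := by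
    rw [hx]
    simp only
    rw [mul_div_assoc', div_le_div_iff₀ hs0 hnp]
    nlinarith
  have hroot : 0 < √(1 - 3 * x m) := Real.sqrt_pos.mpr (by linarith)
  refine le_trans (ENNReal.ofReal_le_ofReal ?_)
    (measure_disc_eq_one_ge (hA m) hppos hph (by linarith) (by linarith) (K := U m) ?_)
  · refine sub_le_sub_left (pow_le_pow_left₀ ?_ ?_ _) _
    · have : 0 ≤ (1 - 2 * (p m : ℝ)) ^ n m := pow_nonneg (by linarith) _
      positivity
    -- Since `2np ≥ 1`, the probability that a row is even is at most `(1 + 1/e)/2 < 3/4`.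
    · have h1 : (1 - 2 * (p m : ℝ)) ^ n m ≤ Real.exp (-1) := by
        calc _ ≤ Real.exp (-(2 * p m)) ^ n m := by
              refine pow_le_pow_left₀ (by linarith) ?_ _
              linarith [Real.add_one_le_exp (-(2 * (p m : ℝ)))]
          _ = Real.exp (n m * -(2 * p m)) := by rw [Real.exp_nat_mul]
          _ ≤ Real.exp (-1) := by gcongr; linarith
      have h2 := Real.exp_neg_one_lt_d9
      linarith
  · refine add_le_add ?_ (exp_mul_two_sqrt_pow_le (by omega) hk4096 (by linarith))
    gcongr
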